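/- Let $n,m\ge 1$ and let $f=(f_1,\dots,f_m):\mathbb R^n\to\mathbb R^m$ be a polynomial map, $f_i(x)=\sum_\alpha a^i_\alpha x^\alpha$. Let $$\Gamma(f)=\operatorname{conv}\Big(\bigcup_{i=1}^m\{\alpha\in\mathbb Z_{\ge0}^n: a^i_\alpha\ne0\}\Big)$$ be its Newton polyhedron. Here a face of a polytope means a nonempty face, the polytope itself included. For a face $\Delta$ of $\Gamma(f)$ put $f_{i,\Delta}(x)=\sum_{\alpha\in\Delta}a^i_\alpha x^\alpha$. Suppose that $f$ satisfies the Mikhailov–Gindikin condition: for every face $\Delta$ of $\Gamma(f)$ and every $x\in(\mathbb R\setminus\{0\})^n$ one has $\max_{1\le i\le m}|f_{i,\Delta}(x)|\neq0$. For $r>0$ let $$Z^f(r)=\{a\in\mathbb Z^n:\ a_j\neq0\ (1\le j\le n),\ |f_i(a)|\le r\ (1\le i\le m)\}.$$ (i) $\operatorname{Card}Z^f(r)<\infty$ for all $r>0$ if and only if the cone $\{\lambda x:\lambda\ge0,\ x\in\Gamma(f)\}$ contains a point all of whose coordinates are positive. (ii) Suppose $\operatorname{Card}Z^f(r)<\infty$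 for all $r>0$. Let $$\widetilde\Gamma(f)=\Gamma(f)\cup\{\alpha\in\mathbb R^n:\ \alpha_j\ge0\ (1\le j\le n)\text{ and there is }\beta\in\Gamma(f)\text{ with }\alpha_j\le\beta_j\ (1\le j\le n)\}$$ be the complete Newton polyhedron. Then there is a largest $\tilde d>0$ with $D=(\tilde d,\dots,\tilde d)\in\widetilde\Gamma(f)$, and there is a face of $\widetilde\Gamma(f)$ containing $D$ in its relative interior. Put $\theta'=1/\tilde d$ and let $k'$ be the smallest dimension of such a face. Then $$\operatorname{Card}Z^f(r)\asymp r^{\theta'}(\ln r)^{\,n-k'-1}\qquad(r\to\infty),$$ that is, there are constants $K_1,K_2>0$ (depending on $f$, not on $r$) such that for all sufficiently large $r$ $$K_1\,r^{\theta'}(\ln r)^{n-k'-1}\le\operatorname{Card}Z^f(r)\le K_2\,r^{\theta'}(\ln r)^{n-k'-1}.$$ -/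

import Mathlib

namespace NewtonLattice

/-- The exponent of a monomial, viewed as a point of `ℝⁿ`. -/
def expVec {n : ℕ} (α : Fin n →₀ ℕ) : Fin n → ℝ := fun j => (α j : ℝ)

/-- The Newton polyhedron `Γ(f)` of a polynomial map `f = (f₁, …, fₘ) : ℝⁿ → ℝᵐ`: the convex hull
of the union of the supports of its components. -/
def newtonPolyhedron {n m : ℕ} (f : Fin m → MvPolynomial (Fin n) ℝ) : Set (Fin n → ℝ) :=
  convexHull ℝ (⋃ i, expVec '' ((f i).support : Set (Fin n →₀ ℕ)))

/-- The complete Newton polyhedron `Γ̃(f)`: `Γ(f)` together with all points of the closed positive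
orthant that lie coordinatewise below some point of `Γ(f)`. -/
def completeNewtonPolyhedron {n m : ℕ} (f : Fin m → MvPolynomial (Fin n) ℝ) : Set (Fin n → ℝ) :=
  newtonPolyhedron f ∪ {α | (∀ j, 0 ≤ α j) ∧ ∃ β ∈ newtonPolyhedron f, ∀ j, α j ≤ β j}

/-- (Nonempty) faces of a polyhedron `P`: the nonempty subsets of `P` on which some linear
functional attains its maximum over `P`. The zero functional gives `P` itself as a face. -/
def IsFace {n : ℕ} (P Δ : Set (Fin n → ℝ)) : Prop :=
  Δ.Nonempty ∧ IsExposed ℝ P Δ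

/-- The dimension of (the affine hull of) a set. -/
noncomputable def dim {n : ℕ} (Δ : Set (Fin n → ℝ)) : ℕ :=
  Module.finrank ℝ (vectorSpan ℝ Δ)

open Classical in
/-- The part `p_Δ` of the polynomial `p` made of its monomials with exponent in `Δ`. -/
noncomputable def facePart {n : ℕ} (Δ : Set (Fin n → ℝ)) (p : MvPolynomial (Fin n) ℝ) :
    MvPolynomial (Fin n) ℝ :=
  ∑ α ∈ p.support.filter (fun α => expVec α ∈ Δ), MvPolynomial.monomial α (p.coeff α)

/-- The Mikhailov–Gindikin condition: for every face `Δ` of `Γ(f)`, the quantity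
`max_i |f_{i,Δ}(x)|` vanishes at no point `x` of `(ℝ ∖ {0})ⁿ`. -/
def MikhailovGindikin {n m : ℕ} (f : Fin m → MvPolynomial (Fin n) ℝ) : Prop :=
  ∀ Δ, IsFace (newtonPolyhedron f) Δ → ∀ x : Fin n → ℝ, (∀ j, x j ≠ 0) →
    ∃ i, MvPolynomial.eval x (facePart Δ (f i)) ≠ 0

/-- The sublevel set `G^f(r) = {x ∈ ℝⁿ : |fᵢ(x)| ≤ r for all i}`. -/
def sublevel {n m : ℕ} (f : Fin m → MvPolynomial (Fin n) ℝ) (r : ℝ) : Set (Fin n → ℝ) :=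
  {x | ∀ i, |MvPolynomial.eval x (f i)| ≤ r}

/-- `Z^f(r)`: the integer points with all coordinates nonzero that lie in `G^f(r)`. -/
def latticePoints {n m : ℕ} (f : Fin m → MvPolynomial (Fin n) ℝ) (r : ℝ) : Set (Fin n → ℤ) :=
  {a | (∀ j, a j ≠ 0) ∧ (fun j => (a j : ℝ)) ∈ sublevel f r}

/-- The cone `{λ x : λ ≥ 0, x ∈ A}` generated by a (convex) set. -/
def coneOf {n : ℕ} (A : Set (Fin n → ℝ)) : Set (Fin n → ℝ) :=
  {y | ∃ c : ℝ, 0 ≤ c ∧ ∃ x ∈ A, y = c • x}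

/-- The open positive orthant of `ℝⁿ`. -/
def openOrthant (n : ℕ) : Set (Fin n → ℝ) := {y | ∀ j, 0 < y j}

/-- `(d, …, d)` is the point furthest from the origin in the intersection of `A` with the diagonal
of the positive orthant. -/
def IsFurthestDiagonal {n : ℕ} (A : Set (Fin n → ℝ)) (d : ℝ) : Prop :=
  IsGreatest {t : ℝ | 0 < t ∧ (fun _ => t) ∈ A} d

/-- `Λ` is a face of `P` of smallest dimension among the faces that contain `D` in their
(relative) interior. -/
def IsSmallestFaceAt {n : ℕ} (P : Set (Fin n → ℝ)) (D : Fin n → ℝ) (Λ : Set (Fin n → ℝ)) : Prop :=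
  (IsFace P Λ ∧ D ∈ intrinsicInterior ℝ Λ) ∧
    ∀ Λ', IsFace P Λ' → D ∈ intrinsicInterior ℝ Λ' → dim Λ ≤ dim Λ'

end NewtonLattice

/-!
The counting problem reduces to one about monomials. By compactness, the Mikhailov–Gindikin condition
gives `|x ^ α| ≤ C * max |fᵢ x|` for all exponents `α` of `f` and all `x` with nonzero coordinates
(`MikhailovGindikin.exists_monomialValue_le`): were this false along a sequence of points, then, after
division by the largest monomial and passage to an ultrafilter limit, the monomials that do not tend
to zero would be those on a face `Δ`, their limits would be proportional to the values of the
monomials at a genuine point of the torus, and all `f_{i,Δ}` would vanish there. Hence `Z^f(r)` lies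
between the sets of integer points with `|a ^ α| ≤ c * r` for all `α`, for two values of `c`. Part (i)
follows, since these sets are all finite exactly when every variable occurs.

For part (ii), decompose dyadically, `|a j| ∈ [2 ^ u j, 2 ^ (u j + 1))`. The number of points becomes
comparable to the sum of `2 ^ (u₁ + ⋯ + uₙ)` over the lattice points `u` of `T • Q`, where
`T = log₂ r` up to a bounded term and `Q = {u ≥ 0 | ∀ α, α ⬝ u ≤ 1}` is the polar polytope of `Γ̃(f)`.
By linear programming duality the maximum of the coordinate sum on `Q` is `1 / d`, and it is attained
on the face dual to the face `Λ` of `Γ̃(f)` around `D = (d, …, d)`, which has dimension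
`n - 1 - dim Λ`. Both facts come from strict complementarity (`exists_strictly_complementary`, packaged
as `DiagonalSupport`): `D` is a convex combination with positive weights of exactly those vertices that
lie on a supporting hyperplane `x ⬝ u = 1`.

* Upper bound (`DiagonalSupport.exists_sum_two_pow_le`): the coordinate sum equals `T / d` minus a
  positive combination of the slacks `T - b ⬝ u` of the vertices `b` of `Λ`. A basis of `ℝⁿ` made of
  `dim Λ + 1` such vertices and `n - 1 - dim Λ` coordinate vectors turns the sum into a product of
  convergent geometric series and `n - 1 - dim Λ` factors of size `O(T)`.
* Lower bound (`DiagonalSupport.exists_lattice_points_near_dual_face`): rounding down a grid of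
  `≍ T ^ (n - 1 - dim Λ)` points of the dilated dual face gives distinct lattice points of `T • Q` whose
  coordinate sum is within `n` of `T / d`.
-/

namespace NewtonLattice

open Filter Topology

/-! ### Farkas' lemma -/

/-- Farkas' lemma for finitely many vectors: a vector on which every functional nonpositive on
the `a i` is nonpositive is a nonnegative combination of the `a i`. -/
theorem exists_nonneg_combination {E ι : Type*} [AddCommGroup E] [Module ℝ E] [DecidableEq ι]
    (s : Finset ι) (a : ι → E) (b : E)
    (h : ∀ l : E →ₗ[ℝ] ℝ, (∀ i ∈ s, l (a i) ≤ 0) → l b ≤ 0) :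
    ∃ c : ι → ℝ, (∀ i ∈ s, 0 ≤ c i) ∧ b = ∑ i ∈ s, c i • a i := by
  induction s using Finset.induction_on generalizing a b with
  | empty =>
    refine ⟨0, by simp, ?_⟩
    have : b = 0 := by
      rw [← Module.forall_dual_apply_eq_zero_iff ℝ b]
      intro φ
      have h1 := h φ (by simp)
      have h2 := h (-φ) (by simp)
      simp only [LinearMap.neg_apply] at h2
      linarith
    simp [this]
  | insert i₀ s hi₀ ih =>
    have key : ∀ (c : ι → ℝ) (t : ℝ), (∀ i ∈ s, 0 ≤ c i) → 0 ≤ t →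
        b = t • a i₀ + ∑ i ∈ s, c i • a i →
        ∃ c : ι → ℝ, (∀ i ∈ insert i₀ s, 0 ≤ c i) ∧ b = ∑ i ∈ insert i₀ s, c i • a i := by
      intro c t hc ht hb
      refine ⟨Function.update c i₀ t, ?_, ?_⟩
      · intro i hi
        by_cases hii : i = i₀
        · subst hii; simpa using ht
        · rw [Function.update_of_ne hii]
          exact hc i ((Finset.mem_insert.1 hi).resolve_left hii)
      · rw [Finset.sum_insert hi₀, hb, Function.update_self]
        congr 1
        refine Finset.sum_congr rfl fun i hi => ?_
        rw [Function.update_of_ne (by rintro rfl; exact hi₀ hi)]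
    by_cases hs : ∀ l : E →ₗ[ℝ] ℝ, (∀ i ∈ s, l (a i) ≤ 0) → l b ≤ 0
    · obtain ⟨c, hc, hb⟩ := ih a b hs
      exact key c 0 hc le_rfl (by simpa using hb)
    · push Not at hs
      obtain ⟨l, hl, hlb⟩ := hs
      have h0 : 0 < l (a i₀) := by
        by_contra hcon
        push Not at hcon
        have := h l (by simpa [hcon] using hl)
        linarith
      -- the projection onto the kernel of `l` along `a i₀` reduces to one vector less
      obtain ⟨c, hc, hb⟩ := ih (fun i => a i - (l (a i) / l (a i₀)) • a i₀)
        (b - (l b / l (a i₀)) • a i₀) (by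
          intro l' hl'
          have := h (l' - (l' (a i₀) / l (a i₀)) • l) (by
            intro i hi
            rcases Finset.mem_insert.1 hi with rfl | hi
            · simp only [LinearMap.sub_apply, LinearMap.smul_apply, smul_eq_mul]
              field_simp; simp
            · have := hl' i hi
              simp only [map_sub, map_smul, smul_eq_mul] at this
              simp only [LinearMap.sub_apply, LinearMap.smul_apply, smul_eq_mul]
              calc _ = _ := by ring
                _ ≤ 0 := this)
          simp only [LinearMap.sub_apply, LinearMap.smul_apply, smul_eq_mul] at this
          simp only [map_sub, map_smul, smul_eq_mul]
          calc _ = _ := by ring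
            _ ≤ 0 := this)
      refine key c (l b / l (a i₀) - ∑ i ∈ s, c i * (l (a i) / l (a i₀))) hc ?_ ?_
      · have : ∑ i ∈ s, c i * (l (a i) / l (a i₀)) ≤ 0 :=
          Finset.sum_nonpos fun i hi =>
            mul_nonpos_of_nonneg_of_nonpos (hc i hi) (div_nonpos_of_nonpos_of_nonneg (hl i hi) h0.le)
        have : 0 < l b / l (a i₀) := div_pos hlb h0
        linarith
      · rw [sub_eq_iff_eq_add] at hb
        refine hb.trans ?_
        simp only [smul_sub, Finset.sum_sub_distrib, sub_smul, Finset.sum_smul, smul_smul]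
        abel

/-! ### Relative interiors of faces -/

section IntrinsicInterior

variable {E : Type*} [NormedAddCommGroup E] [NormedSpace ℝ E]

theorem mem_intrinsicInterior_iff_exists_isOpen {s : Set E} {x : E} :
    x ∈ intrinsicInterior ℝ s ↔
      x ∈ affineSpan ℝ s ∧ ∃ U : Set E, IsOpen U ∧ x ∈ U ∧ ∀ y ∈ affineSpan ℝ s, y ∈ U → y ∈ s := by
  rw [mem_intrinsicInterior]
  constructor
  · rintro ⟨y, hy, rfl⟩
    rw [mem_interior] at hy
    obtain ⟨t, hts, ht, hyt⟩ := hy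
    obtain ⟨U, hU, rfl⟩ := isOpen_induced_iff.1 ht
    exact ⟨y.2, U, hU, hyt, fun z hz hzU => @hts ⟨z, hz⟩ hzU⟩
  · rintro ⟨hx, U, hU, hxU, h⟩
    refine ⟨⟨x, hx⟩, ?_, rfl⟩
    rw [mem_interior]
    exact ⟨((↑) : affineSpan ℝ s → E) ⁻¹' U, fun z hz => h z z.2 hz, hU.preimage continuous_subtype_val, hxU⟩

/-- A segment ending at a relative interior point can be prolonged inside the set. -/
theorem exists_prolong_of_mem_intrinsicInterior {s : Set E} {x p : E}
    (hx : x ∈ intrinsicInterior ℝ s) (hp : p ∈ affineSpan ℝ s) :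
    ∃ ε : ℝ, 0 < ε ∧ x + ε • (x - p) ∈ s := by
  obtain ⟨hxs, U, hU, hxU, h⟩ := mem_intrinsicInterior_iff_exists_isOpen.1 hx
  have hc : Tendsto (fun ε : ℝ => x + ε • (x - p)) (𝓝[>] 0) (𝓝 x) := by
    have : ContinuousAt (fun ε : ℝ => x + ε • (x - p)) 0 := by fun_prop
    have h2 := this.tendsto
    simp only [zero_smul, add_zero] at h2
    exact h2.mono_left nhdsWithin_le_nhds
  obtain ⟨ε, hε, hε0⟩ := ((hc.eventually (hU.mem_nhds hxU)).and self_mem_nhdsWithin).exists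
  refine ⟨ε, hε0, h _ ?_ hε⟩
  have := AffineMap.lineMap_mem (Q := affineSpan ℝ s) (-ε) hxs hp
  rw [AffineMap.lineMap_apply_module'] at this
  convert this using 1
  module

/-- A point of a convex set is in the relative interior as soon as every segment ending there can
be prolonged inside the set. -/
theorem mem_intrinsicInterior_of_prolong [FiniteDimensional ℝ E] {s : Set E} {x : E}
    (hs : Convex ℝ s) (hx : x ∈ s) (h : ∀ p ∈ s, ∃ ε : ℝ, 0 < ε ∧ x + ε • (x - p) ∈ s) :
    x ∈ intrinsicInterior ℝ s := by
  obtain ⟨p, hp⟩ := Set.Nonempty.intrinsicInterior hs ⟨x, hx⟩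
  obtain ⟨ε, hε, hz⟩ := h p (intrinsicInterior_subset hp)
  obtain ⟨hpa, U, hU, hpU, hUs⟩ := mem_intrinsicInterior_iff_exists_isOpen.1 hp
  have hxa := subset_affineSpan ℝ s hx
  refine mem_intrinsicInterior_iff_exists_isOpen.2 ⟨hxa,
    (fun y => p + ((1 + ε) / ε) • (y - x)) ⁻¹' U, hU.preimage (by fun_prop), by simpa using hpU, ?_⟩
  intro y hy hyU
  have h1 : p + ((1 + ε) / ε) • (y - x) ∈ s := by
    refine hUs _ ?_ hyU
    have := AffineSubspace.vadd_mem_of_mem_direction (Submodule.smul_mem _ ((1 + ε) / ε)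
      (AffineSubspace.vsub_mem_direction hy hxa)) hpa
    rw [vadd_eq_add, vsub_eq_sub, add_comm] at this
    exact this
  have h2 := hs hz h1 (a := 1 / (1 + ε)) (b := ε / (1 + ε)) (by positivity) (by positivity)
    (by field_simp)
  convert h2 using 1
  match_scalars <;> field_simp <;> ring

/-- Two exposed faces of a set with a common relative interior point coincide. -/
theorem IsExposed.subset_of_mem_intrinsicInterior {P Λ Λ' : Set E} {x : E}
    (hΛ : IsExposed ℝ P Λ) (hΛ' : IsExposed ℝ P Λ') (hx : x ∈ intrinsicInterior ℝ Λ)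
    (hx' : x ∈ Λ') : Λ ⊆ Λ' := by
  intro p hp
  obtain ⟨ε, hε, hz⟩ := exists_prolong_of_mem_intrinsicInterior hx (subset_affineSpan ℝ Λ hp)
  obtain ⟨l, hl⟩ := hΛ' ⟨x, hx'⟩
  rw [hl] at hx' ⊢
  refine ⟨hΛ.subset hp, fun y hy => (hx'.2 y hy).trans ?_⟩
  have := hx'.2 _ (hΛ.subset hz)
  simp only [map_add, map_smul, map_sub, smul_eq_mul] at this
  have : ε * (l x - l p) ≤ 0 := by linarith
  by_contra hcon
  push Not at hcon
  nlinarith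

end IntrinsicInterior

/-! ### Strict complementarity -/

section StrictComplementarity

variable {E : Type*} [NormedAddCommGroup E] [NormedSpace ℝ E]

/-- Strict complementarity: through a point `D` of a polytope there is a supporting functional such
that `D` is a convex combination in which exactly the vertices on the supporting hyperplane have
positive weight. -/
theorem exists_strictly_complementary (V : Finset E) {D : E}
    (hD : D ∈ convexHull ℝ (V : Set E)) :
    ∃ (l : E →ₗ[ℝ] ℝ) (w : E → ℝ), (∀ v ∈ V, l v ≤ l D) ∧ (∀ v ∈ V, 0 ≤ w v) ∧
      (∀ v ∈ V, l v = l D ↔ 0 < w v) ∧ ∑ v ∈ V, w v = 1 ∧ ∑ v ∈ V, w v • v = D := by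
  classical
  have hch : ∀ v, ∃ l : E →ₗ[ℝ] ℝ, (∀ v ∈ V, l v ≤ l D) ∧
      ((∃ l' : E →ₗ[ℝ] ℝ, (∀ v ∈ V, l' v ≤ l' D) ∧ l' v < l' D) → l v < l D) := by
    intro v
    by_cases h : ∃ l' : E →ₗ[ℝ] ℝ, (∀ v ∈ V, l' v ≤ l' D) ∧ l' v < l' D
    · obtain ⟨l', h1, h2⟩ := h
      exact ⟨l', h1, fun _ => h2⟩
    · exact ⟨0, by simp, fun h' => absurd h' h⟩
  choose L hL1 hL2 using hch
  set l : E →ₗ[ℝ] ℝ := ∑ v ∈ V, L v with hl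
  have hlV : ∀ v ∈ V, l v ≤ l D := by
    intro v hv
    simp only [hl, LinearMap.sum_apply]
    exact Finset.sum_le_sum fun w _ => hL1 w v hv
  have hforce : ∀ v ∈ V, l v = l D → ∀ l' : E →ₗ[ℝ] ℝ, (∀ v ∈ V, l' v ≤ l' D) → l' D ≤ l' v := by
    intro v hv hlv l' hl'
    by_contra hcon
    push Not at hcon
    have h1 := hL2 v ⟨l', hl', hcon⟩
    have : l v < l D := by
      simp only [hl, LinearMap.sum_apply]
      exact Finset.sum_lt_sum (fun w _ => hL1 w v hv) ⟨v, hv, h1⟩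
    linarith
  have hcomb : ∀ v, ∃ c : E → ℝ, (∀ w ∈ V, 0 ≤ c w) ∧ ∑ w ∈ V, c w • (w - D) = 0 ∧
      (v ∈ V → l v = l D → 0 < c v) := by
    intro v
    by_cases hv : v ∈ V ∧ l v = l D
    · obtain ⟨c, hc, hcD⟩ := exists_nonneg_combination V (fun w => w - D) (D - v) (by
        intro l' hl'
        have := hforce v hv.1 hv.2 l' (fun w hw => by
          have := hl' w hw
          rw [map_sub] at this; linarith)
        rw [map_sub]; linarith)
      refine ⟨fun w => c w + if w = v then 1 else 0, ?_, ?_, ?_⟩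
      · intro w hw
        have := hc w hw
        positivity
      · simp only [add_smul, Finset.sum_add_distrib, ← hcD, ite_smul, one_smul, zero_smul]
        rw [Finset.sum_ite_eq' V v, if_pos hv.1]
        abel
      · intro h1 _
        have := hc v h1
        simp only [if_true]
        linarith
    · exact ⟨0, by simp, by simp, fun h1 h2 => absurd ⟨h1, h2⟩ hv⟩
  choose c hc0 hcD hcpos using hcomb
  set μ : E → ℝ := fun w => ∑ v ∈ V, c v w with hμ
  have hμ0 : ∀ w ∈ V, 0 ≤ μ w := fun w hw => Finset.sum_nonneg fun v _ => hc0 v w hw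
  have hμpos : ∀ w ∈ V, l w = l D → 0 < μ w := fun w hw hlw =>
    Finset.sum_pos' (fun v _ => hc0 v w hw) ⟨w, hw, hcpos w hw hlw⟩
  have hμD : ∑ w ∈ V, μ w • (w - D) = 0 := by
    simp only [hμ, Finset.sum_smul]
    rw [Finset.sum_comm]
    exact Finset.sum_eq_zero fun v _ => hcD v
  have hμzero : ∀ w ∈ V, 0 < μ w → l w = l D := by
    have h1 : ∑ w ∈ V, μ w * (l D - l w) = 0 := by
      have := congrArg l hμD
      simp only [map_sum, map_smul, map_sub, map_zero, smul_eq_mul] at this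
      rw [← neg_eq_zero, ← this, ← Finset.sum_neg_distrib]
      exact Finset.sum_congr rfl fun w _ => by ring
    rw [Finset.sum_eq_zero_iff_of_nonneg
      (fun w hw => mul_nonneg (hμ0 w hw) (sub_nonneg.2 (hlV w hw)))] at h1
    intro w hw hpos
    rcases mul_eq_zero.1 (h1 w hw) with h | h
    · linarith
    · linarith
  obtain ⟨v₀, hv₀, hlv₀⟩ : ∃ v ∈ V, l v = l D := by
    by_contra hcon
    push Not at hcon
    have hsub : convexHull ℝ (V : Set E) ⊆ {x | l x < l D} :=
      convexHull_min (fun v hv => lt_of_le_of_ne (hlV v hv) (hcon v hv))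
        (convex_halfSpace_lt l.isLinear _)
    exact (lt_irrefl (l D) (show l D < l D from hsub hD)).elim
  have hM : 0 < ∑ w ∈ V, μ w := Finset.sum_pos' hμ0 ⟨v₀, hv₀, hμpos v₀ hv₀ hlv₀⟩
  refine ⟨l, fun w => (∑ w ∈ V, μ w)⁻¹ * μ w, hlV,
    fun v hv => mul_nonneg (by positivity) (hμ0 v hv), ?_, ?_, ?_⟩
  · intro v hv
    rw [mul_pos_iff_of_pos_left (by positivity)]
    exact ⟨hμpos v hv, hμzero v hv⟩
  · rw [← Finset.mul_sum, inv_mul_cancel₀ hM.ne']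
  · simp only [mul_smul]
    rw [← Finset.smul_sum]
    simp only [smul_sub, Finset.sum_sub_distrib, ← Finset.sum_smul] at hμD
    rw [sub_eq_zero] at hμD
    rw [hμD, smul_smul, inv_mul_cancel₀ hM.ne', one_smul]

/-- In the situation of strict complementarity, the face exposed by the functional has `D` in its
relative interior. -/
theorem mem_intrinsicInterior_face [FiniteDimensional ℝ E] (V : Finset E) {D : E}
    {l : E →ₗ[ℝ] ℝ} {w : E → ℝ}
    (hl : ∀ v ∈ V, l v ≤ l D) (hw0 : ∀ v ∈ V, 0 ≤ w v) (hlw : ∀ v ∈ V, l v = l D ↔ 0 < w v)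
    (hw1 : ∑ v ∈ V, w v = 1) (hwD : ∑ v ∈ V, w v • v = D) :
    D ∈ intrinsicInterior ℝ {x ∈ convexHull ℝ (V : Set E) | l x = l D} := by
  classical
  have hD : D ∈ convexHull ℝ (V : Set E) := by
    rw [Finset.mem_convexHull']
    exact ⟨w, hw0, hw1, hwD⟩
  refine mem_intrinsicInterior_of_prolong
    ((convex_convexHull ℝ _).inter (convex_hyperplane l.isLinear _)) ⟨hD, rfl⟩ ?_
  rintro p ⟨hp, hlp⟩
  obtain ⟨μ, hμ0, hμ1, hμp⟩ := Finset.mem_convexHull'.1 hp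
  have hμz : ∀ v ∈ V, w v = 0 → μ v = 0 := by
    have h1 : ∑ v ∈ V, μ v * (l D - l v) = 0 := by
      have := congrArg l hμp
      simp only [map_sum, map_smul, smul_eq_mul] at this
      simp only [mul_sub, Finset.sum_sub_distrib, ← Finset.sum_mul, hμ1, this, hlp]
      ring
    rw [Finset.sum_eq_zero_iff_of_nonneg
      (fun v hv => mul_nonneg (hμ0 v hv) (sub_nonneg.2 (hl v hv)))] at h1
    intro v hv hwv
    rcases mul_eq_zero.1 (h1 v hv) with h | h
    · exact h
    · have := (hlw v hv).1 (by linarith)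
      linarith
  have hev : ∀ᶠ ε : ℝ in 𝓝[>] 0, ∀ v ∈ V, 0 < w v → ε < w v := by
    rw [Finset.eventually_all]
    intro v _
    by_cases hv : 0 < w v
    · filter_upwards [nhdsWithin_le_nhds (Iio_mem_nhds hv)] with ε hε _ using hε
    · exact Eventually.of_forall fun _ h => absurd h hv
  obtain ⟨ε, hε, hε0⟩ := (hev.and self_mem_nhdsWithin).exists
  have hε0 : 0 < ε := hε0
  refine ⟨ε, hε0, ?_, by simp [hlp]⟩
  rw [Finset.mem_convexHull']
  refine ⟨fun v => (1 + ε) * w v - ε * μ v, ?_, ?_, ?_⟩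
  · intro v hv
    rcases (hw0 v hv).eq_or_lt with h | h
    · simp [← h, hμz v hv h.symm]
    · have h1 := hε v hv h
      have h2 : μ v ≤ 1 := hμ1 ▸ Finset.single_le_sum hμ0 hv
      have : ε * μ v ≤ ε := mul_le_of_le_one_right hε0.le h2
      nlinarith
  · rw [Finset.sum_sub_distrib, ← Finset.mul_sum, ← Finset.mul_sum, hw1, hμ1]; ring
  · simp only [sub_smul, mul_smul, Finset.sum_sub_distrib, ← Finset.smul_sum, hwD, hμp]
    module

end StrictComplementarity

/-! ### The Mikhailov–Gindikin inequality -/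

variable {n m : ℕ}

/-- The union of the supports of the components of `f`. -/
noncomputable def exponents (f : Fin m → MvPolynomial (Fin n) ℝ) : Finset (Fin n →₀ ℕ) := by
  classical exact Finset.univ.biUnion fun i => (f i).support

theorem mem_exponents {f : Fin m → MvPolynomial (Fin n) ℝ} {α : Fin n →₀ ℕ} :
    α ∈ exponents f ↔ ∃ i, α ∈ (f i).support := by
  simp [exponents]

theorem newtonPolyhedron_eq (f : Fin m → MvPolynomial (Fin n) ℝ) :
    newtonPolyhedron f = convexHull ℝ (expVec '' (exponents f : Set (Fin n →₀ ℕ))) := by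
  unfold newtonPolyhedron
  congr 1
  ext v
  simp only [Set.mem_iUnion, Set.mem_image, Finset.mem_coe, mem_exponents]
  tauto

theorem expVec_mem_newtonPolyhedron {f : Fin m → MvPolynomial (Fin n) ℝ} {α : Fin n →₀ ℕ}
    (hα : α ∈ exponents f) : expVec α ∈ newtonPolyhedron f := by
  rw [newtonPolyhedron_eq]
  exact subset_convexHull ℝ _ ⟨α, hα, rfl⟩

/-- The value `x ^ α` of a monomial. -/
def monomialValue (x : Fin n → ℝ) (α : Fin n →₀ ℕ) : ℝ := ∏ j, x j ^ α j

theorem eval_eq_sum_monomialValue (x : Fin n → ℝ) (p : MvPolynomial (Fin n) ℝ) :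
    MvPolynomial.eval x p = ∑ α ∈ p.support, p.coeff α * monomialValue x α :=
  MvPolynomial.eval_eq' x p

open Classical in
theorem eval_facePart (Δ : Set (Fin n → ℝ)) (x : Fin n → ℝ) (p : MvPolynomial (Fin n) ℝ) :
    MvPolynomial.eval x (facePart Δ p) =
      ∑ α ∈ p.support.filter (fun α => expVec α ∈ Δ), p.coeff α * monomialValue x α := by
  unfold facePart
  rw [map_sum]
  refine Finset.sum_congr (by congr) fun α _ => ?_
  rw [MvPolynomial.eval_monomial, Finsupp.prod_fintype _ _ (by simp)]
  rfl

theorem abs_monomialValue (x : Fin n → ℝ) (α : Fin n →₀ ℕ) :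
    |monomialValue x α| = monomialValue (fun j => |x j|) α := by
  simp [monomialValue, Finset.abs_prod]

theorem monomialValue_exp (y : Fin n → ℝ) (α : Fin n →₀ ℕ) :
    monomialValue (fun j => Real.exp (y j)) α = Real.exp (expVec α ⬝ᵥ y) := by
  simp [monomialValue, dotProduct, expVec, Real.exp_sum, Real.exp_nat_mul]

theorem monomialValue_mul (x y : Fin n → ℝ) (α : Fin n →₀ ℕ) :
    monomialValue (fun j => x j * y j) α = monomialValue x α * monomialValue y α := by
  simp [monomialValue, mul_pow, Finset.prod_mul_distrib]

theorem abs_monomialValue_eq_exp {x : Fin n → ℝ} (hx : ∀ j, x j ≠ 0) (α : Fin n →₀ ℕ) :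
    |monomialValue x α| = Real.exp (expVec α ⬝ᵥ fun j => Real.log |x j|) := by
  rw [abs_monomialValue, ← monomialValue_exp]
  congr 1
  ext j
  rw [Real.exp_log (abs_pos.2 (hx j))]

/-- A linear map between finite-dimensional spaces has a generalized inverse. -/
theorem exists_generalized_inverse {E F : Type*} [AddCommGroup E] [Module ℝ E] [AddCommGroup F]
    [Module ℝ F] (L : E →ₗ[ℝ] F) : ∃ G : F →ₗ[ℝ] E, ∀ y, L (G (L y)) = L y := by
  obtain ⟨g, hg⟩ := L.rangeRestrict.exists_rightInverse_of_surjective L.range_rangeRestrict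
  obtain ⟨G, hG⟩ := LinearMap.exists_extend g
  refine ⟨G, fun y => ?_⟩
  have h1 : G (L y) = g (L.rangeRestrict y) := by
    rw [← hG]; rfl
  have h2 := congrArg Subtype.val (LinearMap.congr_fun hg (L.rangeRestrict y))
  simpa [h1] using h2

/-- Along an ultrafilter, a function with values in a finite set is eventually constant. -/
theorem exists_eventually_eq_of_mem_finset {ι X : Type*} (U : Ultrafilter ι) (S : Finset X)
    (a : ι → X) (ha : ∀ k, a k ∈ S) : ∃ β ∈ S, ∀ᶠ k in (U : Filter ι), a k = β := by
  by_contra hcon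
  push Not at hcon
  have h : ∀ᶠ k in (U : Filter ι), ∀ β ∈ S, a k ≠ β := by
    rw [Finset.eventually_all]
    intro β hβ
    exact hcon β hβ
  obtain ⟨k, hk⟩ := h.exists
  exact hk _ (ha k) rfl

/-- Suppose that along an ultrafilter the exponentials `exp ((v α - v β) ⬝ y k)` converge for
`α ∈ S`. Then their nonzero limits are of the same form, and the indices `α` with a nonzero limit
are those where some linear functional attains its maximum on `v '' S`. -/
theorem exists_exposing_of_tendsto {ι A : Type*} (U : Ultrafilter ι) (S : Finset A)
    (v : A → Fin n → ℝ) (β : A) (y : ι → Fin n → ℝ) (q : A → ℝ)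
    (hq : ∀ α ∈ S, Tendsto (fun k => Real.exp ((v α - v β) ⬝ᵥ y k)) U (𝓝 (q α))) :
    ∃ y₀ η : Fin n → ℝ, ∀ α ∈ S,
      (q α ≠ 0 → q α = Real.exp ((v α - v β) ⬝ᵥ y₀) ∧ (v α - v β) ⬝ᵥ η = 0) ∧
      (q α = 0 → (v α - v β) ⬝ᵥ η < 0) := by
  classical
  let T : Type _ := {α // α ∈ S.filter fun α => q α ≠ 0}
  let L : (Fin n → ℝ) →ₗ[ℝ] (T → ℝ) :=
    { toFun := fun z α => (v α.1 - v β) ⬝ᵥ z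
      map_add' := fun z w => by ext α; simp [dotProduct_add]
      map_smul' := fun c z => by ext α; simp [dotProduct_smul] }
  have hq0 : ∀ α ∈ S, 0 ≤ q α := fun α hα =>
    ge_of_tendsto (hq α hα) (Eventually.of_forall fun k => (Real.exp_pos _).le)
  let c : T → ℝ := fun α => Real.log (q α.1)
  have hLc : Tendsto (fun k => L (y k)) U (𝓝 c) := by
    rw [tendsto_pi_nhds]
    intro α
    have hα := Finset.mem_filter.1 α.2
    have := (Real.continuousAt_log hα.2).tendsto.comp (hq α.1 hα.1)
    simp only [Function.comp_def, Real.log_exp] at this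
    exact this
  obtain ⟨G, hG⟩ := exists_generalized_inverse L
  have hGc : Continuous G := G.continuous_of_finiteDimensional
  have hLcont : Continuous L := L.continuous_of_finiteDimensional
  have hGy : Tendsto (fun k => G (L (y k))) U (𝓝 (G c)) := (hGc.tendsto c).comp hLc
  have hLG : L (G c) = c := by
    have h1 : Tendsto (fun k => L (G (L (y k)))) U (𝓝 (L (G c))) := (hLcont.tendsto _).comp hGy
    simp only [hG] at h1
    exact tendsto_nhds_unique h1 hLc
  have hneg : ∀ᶠ k in (U : Filter ι), ∀ α ∈ S, q α = 0 → (v α - v β) ⬝ᵥ (y k - G (L (y k))) < 0 := by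
    rw [Finset.eventually_all]
    intro α hα
    by_cases h0 : q α = 0
    · have h1 : Tendsto (fun k => (v α - v β) ⬝ᵥ y k) U atBot := by
        have := hq α hα
        rw [h0] at this
        exact Real.tendsto_exp_comp_nhds_zero.1 this
      have hcont : Continuous fun z : Fin n → ℝ => (v α - v β) ⬝ᵥ z := by
        unfold dotProduct; fun_prop
      have h2 : Tendsto (fun k => -((v α - v β) ⬝ᵥ G (L (y k)))) U
          (𝓝 (-((v α - v β) ⬝ᵥ G c))) := ((hcont.tendsto _).comp hGy).neg
      have h3 := h1.atBot_add h2
      filter_upwards [h3.eventually (eventually_lt_atBot 0)] with k hk _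
      rw [dotProduct_sub]
      linarith
    · exact Eventually.of_forall fun _ h => absurd h h0
  obtain ⟨k, hk⟩ := hneg.exists
  refine ⟨G c, y k - G (L (y k)), fun α hα => ⟨fun h0 => ?_, hk α hα⟩⟩
  have hαT : α ∈ S.filter fun α => q α ≠ 0 := Finset.mem_filter.2 ⟨hα, h0⟩
  constructor
  · have := congrFun hLG ⟨α, hαT⟩
    change (v α - v β) ⬝ᵥ G c = Real.log (q α) at this
    rw [this, Real.exp_log (lt_of_le_of_ne (hq0 α hα) (Ne.symm h0))]
  · have := congrFun (hG (y k)) ⟨α, hαT⟩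
    change (v α - v β) ⬝ᵥ G (L (y k)) = (v α - v β) ⬝ᵥ y k at this
    rw [dotProduct_sub, this, sub_self]

/-- Under the Mikhailov–Gindikin condition the monomials of `f` are bounded on the torus
`(ℝ ∖ {0})ⁿ` by a multiple of `max |fᵢ|`. -/
theorem MikhailovGindikin.exists_monomialValue_le {f : Fin m → MvPolynomial (Fin n) ℝ}
    (hf : MikhailovGindikin f) :
    ∃ C : ℝ, 0 < C ∧ ∀ x : Fin n → ℝ, (∀ j, x j ≠ 0) → ∀ r : ℝ,
      (∀ i, |MvPolynomial.eval x (f i)| ≤ r) → ∀ α ∈ exponents f, |monomialValue x α| ≤ C * r := by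
  classical
  by_contra hcon
  push Not at hcon
  have hex : ∀ k : ℕ, ∃ (x : Fin n → ℝ) (a : Fin n →₀ ℕ), (∀ j, x j ≠ 0) ∧ a ∈ exponents f ∧
      (∀ α ∈ exponents f, |monomialValue x α| ≤ |monomialValue x a|) ∧
      ∀ i, |MvPolynomial.eval x (f i)| ≤ |monomialValue x a| * (1 / ((k : ℝ) + 1)) := by
    intro k
    obtain ⟨x, hx, r, hr, α, hα, hlt⟩ := hcon (k + 1) (by positivity)
    obtain ⟨a, ha, hmax⟩ := Finset.exists_max_image (exponents f)
      (fun α => |monomialValue x α|) ⟨α, hα⟩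
    refine ⟨x, a, hx, ha, hmax, fun i => (hr i).trans ?_⟩
    rw [mul_one_div, le_div_iff₀ (by positivity), mul_comm]
    exact hlt.le.trans (hmax α hα)
  choose x a hx ha hmax hsmall using hex
  set U : Ultrafilter ℕ := hyperfilter ℕ
  obtain ⟨β, hβ, haβ⟩ := exists_eventually_eq_of_mem_finset U (exponents f) a ha
  have hsign : ∀ j, ∃ σ : ℝ, σ ≠ 0 ∧ ∀ᶠ k in (U : Filter ℕ), x k j = σ * |x k j| := by
    intro j
    have : ∀ᶠ k in (U : Filter ℕ), 0 < x k j ∨ x k j < 0 :=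
      Eventually.of_forall fun k => (hx k j).lt_or_gt.symm
    rcases Ultrafilter.eventually_or.1 this with h | h
    · exact ⟨1, one_ne_zero, h.mono fun k hk => by rw [abs_of_pos hk, one_mul]⟩
    · exact ⟨-1, by norm_num, h.mono fun k hk => by rw [abs_of_neg hk]; ring⟩
  choose σ hσ0 hσ using hsign
  set y : ℕ → Fin n → ℝ := fun k j => Real.log |x k j| with hy
  have habs : ∀ k α, |monomialValue (x k) α| = Real.exp (expVec α ⬝ᵥ y k) := fun k α =>
    abs_monomialValue_eq_exp (hx k) α
  have hquot : ∀ k α, Real.exp ((expVec α - expVec β) ⬝ᵥ y k) =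
      |monomialValue (x k) α| / |monomialValue (x k) β| := by
    intro k α
    rw [habs, habs, ← Real.exp_sub, sub_dotProduct]
  have hlim : ∀ α, ∃ q : ℝ, α ∈ exponents f →
      Tendsto (fun k => Real.exp ((expVec α - expVec β) ⬝ᵥ y k)) U (𝓝 q) := by
    intro α
    by_cases hα : α ∈ exponents f
    · obtain ⟨q, _, hq⟩ := (isCompact_Icc (a := (0 : ℝ)) (b := 1)).ultrafilter_le_nhds
        (U.map fun k => Real.exp ((expVec α - expVec β) ⬝ᵥ y k)) (by
          rw [le_principal_iff]
          change ∀ᶠ k in (U : Filter ℕ), Real.exp ((expVec α - expVec β) ⬝ᵥ y k) ∈ Set.Icc 0 1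
          filter_upwards [haβ] with k hk
          refine ⟨(Real.exp_pos _).le, ?_⟩
          rw [hquot]
          have := hmax k α hα
          rw [hk] at this
          exact div_le_one_of_le₀ this (abs_nonneg _))
      exact ⟨q, fun _ => hq⟩
    · exact ⟨0, fun h => absurd h hα⟩
  choose q hq using hlim
  obtain ⟨y₀, η, hyη⟩ := exists_exposing_of_tendsto U (exponents f) expVec β y q hq
  have hqβ : q β = 1 := by
    have := hq β hβ
    simp only [sub_self, zero_dotProduct, Real.exp_zero] at this
    exact tendsto_nhds_unique this tendsto_const_nhds
  have hβη : ∀ α ∈ exponents f, expVec α ⬝ᵥ η ≤ expVec β ⬝ᵥ η := by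
    intro α hα
    have h := hyη α hα
    simp only [sub_dotProduct] at h
    by_cases h0 : q α = 0
    · linarith [h.2 h0]
    · linarith [(h.1 h0).2]
  -- the functional `η` exposes the face spanned by the exponents with nonzero limit
  set l : (Fin n → ℝ) →ₗ[ℝ] ℝ :=
    { toFun := fun v => v ⬝ᵥ η
      map_add' := fun v w => add_dotProduct v w η
      map_smul' := fun c v => smul_dotProduct c v η } with hl
  set Δ : Set (Fin n → ℝ) := {v ∈ newtonPolyhedron f | ∀ w ∈ newtonPolyhedron f, l w ≤ l v} with hΔ
  have hβmax : ∀ w ∈ newtonPolyhedron f, l w ≤ l (expVec β) := by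
    rw [newtonPolyhedron_eq]
    refine convexHull_min ?_ (convex_halfSpace_le l.isLinear _)
    rintro _ ⟨α, hα, rfl⟩
    exact hβη α hα
  have hface : IsFace (newtonPolyhedron f) Δ :=
    ⟨⟨expVec β, expVec_mem_newtonPolyhedron hβ, hβmax⟩, fun _ => ⟨l.toContinuousLinearMap, rfl⟩⟩
  have hmemΔ : ∀ α ∈ exponents f, (expVec α ∈ Δ ↔ q α ≠ 0) := by
    intro α hα
    constructor
    · rintro ⟨_, h⟩ h0
      have h1 := h _ (expVec_mem_newtonPolyhedron hβ)
      have h2 := (hyη α hα).2 h0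
      rw [sub_dotProduct] at h2
      change expVec β ⬝ᵥ η ≤ expVec α ⬝ᵥ η at h1
      linarith
    · intro h0
      refine ⟨expVec_mem_newtonPolyhedron hα, fun w hw => (hβmax w hw).trans ?_⟩
      have h2 := ((hyη α hα).1 h0).2
      rw [sub_dotProduct] at h2
      change expVec β ⬝ᵥ η ≤ expVec α ⬝ᵥ η
      linarith
  obtain ⟨i, hi⟩ := hf Δ hface (fun j => σ j * Real.exp (y₀ j))
    fun j => mul_ne_zero (hσ0 j) (Real.exp_pos _).ne'
  apply hi
  clear_value Δ
  have hsupp : ∀ α ∈ (f i).support, α ∈ exponents f := fun α hα => mem_exponents.2 ⟨i, hα⟩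
  have hsum : ∑ α ∈ (f i).support, (f i).coeff α * (monomialValue σ α * q α) = 0 := by
    have h1 : Tendsto (fun k => ∑ α ∈ (f i).support, (f i).coeff α *
        (monomialValue σ α * Real.exp ((expVec α - expVec β) ⬝ᵥ y k))) U
        (𝓝 (∑ α ∈ (f i).support, (f i).coeff α * (monomialValue σ α * q α))) :=
      tendsto_finsetSum _ fun α hα => ((hq α (hsupp α hα)).const_mul _).const_mul _
    have h2 : Tendsto (fun k : ℕ => 1 / ((k : ℝ) + 1)) U (𝓝 0) :=
      tendsto_one_div_add_atTop_nhds_zero_nat.mono_left Nat.hyperfilter_le_atTop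
    refine tendsto_nhds_unique h1 (squeeze_zero_norm' ?_ h2)
    filter_upwards [haβ, eventually_all.2 hσ] with k hk hσk
    have hpos : 0 < |monomialValue (x k) β| := by rw [habs]; exact Real.exp_pos _
    have : ∑ α ∈ (f i).support, (f i).coeff α *
        (monomialValue σ α * Real.exp ((expVec α - expVec β) ⬝ᵥ y k)) =
        MvPolynomial.eval (x k) (f i) / |monomialValue (x k) β| := by
      rw [eval_eq_sum_monomialValue, Finset.sum_div]
      refine Finset.sum_congr rfl fun α _ => ?_
      have hx' : monomialValue (x k) α = monomialValue σ α * |monomialValue (x k) α| := by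
        rw [abs_monomialValue, ← monomialValue_mul]
        congr 1
        ext j
        exact hσk j
      rw [hquot]
      conv_rhs => rw [hx']
      ring
    rw [this, Real.norm_eq_abs, abs_div, abs_abs, div_le_iff₀ hpos, mul_comm]
    have := hsmall k i
    rwa [hk] at this
  rw [eval_facePart]
  calc ∑ α ∈ (f i).support.filter (fun α => expVec α ∈ Δ),
        (f i).coeff α * monomialValue (fun j => σ j * Real.exp (y₀ j)) α
      = ∑ α ∈ (f i).support.filter (fun α => expVec α ∈ Δ),
        Real.exp (expVec β ⬝ᵥ y₀) * ((f i).coeff α * (monomialValue σ α * q α)) := by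
        refine Finset.sum_congr rfl fun α hα => ?_
        obtain ⟨hα, hαΔ⟩ := Finset.mem_filter.1 hα
        have h0 := (hmemΔ α (hsupp α hα)).1 hαΔ
        rw [monomialValue_mul, monomialValue_exp, ((hyη α (hsupp α hα)).1 h0).1, sub_dotProduct,
          Real.exp_sub]
        field_simp
    _ = ∑ α ∈ (f i).support,
        Real.exp (expVec β ⬝ᵥ y₀) * ((f i).coeff α * (monomialValue σ α * q α)) := by
        refine Finset.sum_subset (Finset.filter_subset _ _) fun α hα hαn => ?_
        have : q α = 0 := by
          by_contra h0
          exact hαn (Finset.mem_filter.2 ⟨hα, (hmemΔ α (hsupp α hα)).2 h0⟩)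
        simp [this]
    _ = 0 := by rw [← Finset.mul_sum, hsum, mul_zero]

/-! ### The complete Newton polyhedron and its supporting hyperplane on the diagonal -/

theorem newtonPolyhedron_nonneg {f : Fin m → MvPolynomial (Fin n) ℝ} {β : Fin n → ℝ}
    (hβ : β ∈ newtonPolyhedron f) (j : Fin n) : 0 ≤ β j := by
  rw [newtonPolyhedron_eq] at hβ
  refine convexHull_min (t := {v : Fin n → ℝ | 0 ≤ v j}) ?_ ?_ hβ
  · rintro _ ⟨α, _, rfl⟩
    exact Nat.cast_nonneg (α := ℝ) (α j)
  · exact convex_halfSpace_ge (LinearMap.proj (R := ℝ) (φ := fun _ : Fin n => ℝ) j).isLinear 0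

theorem mem_completeNewtonPolyhedron {f : Fin m → MvPolynomial (Fin n) ℝ} {γ : Fin n → ℝ} :
    γ ∈ completeNewtonPolyhedron f ↔ (∀ j, 0 ≤ γ j) ∧ ∃ β ∈ newtonPolyhedron f, ∀ j, γ j ≤ β j := by
  constructor
  · rintro (h | h)
    · exact ⟨newtonPolyhedron_nonneg h, γ, h, fun _ => le_rfl⟩
    · exact h
  · exact fun h => Or.inr h

theorem completeNewtonPolyhedron_of_le {f : Fin m → MvPolynomial (Fin n) ℝ} {γ γ' : Fin n → ℝ}
    (hγ : γ ∈ completeNewtonPolyhedron f) (h0 : ∀ j, 0 ≤ γ' j) (h : ∀ j, γ' j ≤ γ j) :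
    γ' ∈ completeNewtonPolyhedron f := by
  obtain ⟨_, β, hβ, hle⟩ := mem_completeNewtonPolyhedron.1 hγ
  exact mem_completeNewtonPolyhedron.2 ⟨h0, β, hβ, fun j => (h j).trans (hle j)⟩

/-- The complete Newton polyhedron is a polytope: its vertices are among the exponents of `f` with
some of their coordinates replaced by zero. -/
theorem exists_completeNewtonPolyhedron_eq_convexHull (f : Fin m → MvPolynomial (Fin n) ℝ) :
    ∃ V : Finset (Fin n → ℝ), completeNewtonPolyhedron f = convexHull ℝ (V : Set (Fin n → ℝ)) := by
  classical
  let cube : Set (Fin n → ℝ) := Set.pi Set.univ fun _ => {0, 1}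
  have hcube : cube.Finite := Set.Finite.pi fun _ => Set.toFinite _
  let V : Set (Fin n → ℝ) :=
    Set.image2 (fun t β => t * β) cube (expVec '' (exponents f : Set (Fin n →₀ ℕ)))
  have hV : V.Finite := hcube.image2 _ ((exponents f).finite_toSet.image _)
  refine ⟨hV.toFinset, ?_⟩
  rw [hV.coe_toFinset]
  apply Set.Subset.antisymm
  · intro γ hγ
    obtain ⟨h0, β, hβ, hle⟩ := mem_completeNewtonPolyhedron.1 hγ
    have h1 : ∀ t ∈ cube, t * β ∈ convexHull ℝ V := by
      intro t ht
      rw [newtonPolyhedron_eq] at hβ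
      exact convexHull_min (t := (LinearMap.mulLeft ℝ t) ⁻¹' convexHull ℝ V)
        (fun v hv => subset_convexHull ℝ V ⟨t, ht, v, hv, rfl⟩)
        ((convex_convexHull ℝ V).linear_preimage _) hβ
    have h2 : ∀ t ∈ convexHull ℝ cube, t * β ∈ convexHull ℝ V := fun t ht =>
      convexHull_min (t := (LinearMap.mulRight ℝ β) ⁻¹' convexHull ℝ V)
        (fun t ht => h1 t ht) ((convex_convexHull ℝ V).linear_preimage _) ht
    have h3 : (fun j => γ j / β j) ∈ convexHull ℝ cube := by
      apply mem_convexHull_pi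
      intro j _
      rw [convexHull_pair, segment_eq_Icc zero_le_one]
      exact ⟨div_nonneg (h0 j) ((h0 j).trans (hle j)), div_le_one_of_le₀ (hle j) ((h0 j).trans (hle j))⟩
    convert h2 _ h3 using 1
    ext j
    simp only [Pi.mul_apply]
    by_cases hj : β j = 0
    · have := h0 j
      have := hle j
      rw [hj] at this ⊢
      simp; linarith
    · field_simp
  · refine convexHull_min ?_ ?_
    · rintro _ ⟨t, ht, _, ⟨α, hα, rfl⟩, rfl⟩
      have htj : ∀ j, 0 ≤ t j ∧ t j ≤ 1 := by
        intro j
        rcases ht j (Set.mem_univ j) with h | h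
        · simp [h]
        · rw [Set.mem_singleton_iff] at h; simp [h]
      have hαj : ∀ j, 0 ≤ expVec α j := fun j => Nat.cast_nonneg _
      exact mem_completeNewtonPolyhedron.2 ⟨fun j => mul_nonneg (htj j).1 (hαj j), expVec α,
        expVec_mem_newtonPolyhedron hα, fun j => mul_le_of_le_one_left (hαj j) (htj j).2⟩
    · intro γ hγ γ' hγ' a b ha hb hab
      obtain ⟨h0, β, hβ, hle⟩ := mem_completeNewtonPolyhedron.1 hγ
      obtain ⟨h0', β', hβ', hle'⟩ := mem_completeNewtonPolyhedron.1 hγ'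
      refine mem_completeNewtonPolyhedron.2 ⟨fun j => ?_, a • β + b • β',
        convex_convexHull ℝ _ hβ hβ' ha hb hab, fun j => ?_⟩
      · have := h0 j
        have := h0' j
        simp only [Pi.add_apply, Pi.smul_apply, smul_eq_mul]
        positivity
      · have := hle j
        have := hle' j
        simp only [Pi.add_apply, Pi.smul_apply, smul_eq_mul]
        gcongr

/-- The inequalities `α ⬝ y ≤ T` for exponents `α` extend to the complete Newton polyhedron. -/
theorem dotProduct_le_of_mem_completeNewtonPolyhedron {f : Fin m → MvPolynomial (Fin n) ℝ}
    {y : Fin n → ℝ} {T : ℝ} (hy : ∀ j, 0 ≤ y j) (hT : ∀ α ∈ exponents f, expVec α ⬝ᵥ y ≤ T)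
    {v : Fin n → ℝ} (hv : v ∈ completeNewtonPolyhedron f) : v ⬝ᵥ y ≤ T := by
  obtain ⟨_, β, hβ, hle⟩ := mem_completeNewtonPolyhedron.1 hv
  have h1 : β ⬝ᵥ y ≤ T := by
    rw [newtonPolyhedron_eq] at hβ
    refine convexHull_min (t := {v : Fin n → ℝ | v ⬝ᵥ y ≤ T}) ?_ ?_ hβ
    · rintro _ ⟨α, hα, rfl⟩
      exact hT α hα
    · exact convex_halfSpace_le ⟨fun v w => add_dotProduct v w y, fun c v => smul_dotProduct c v y⟩ T
  exact (Finset.sum_le_sum fun j _ => mul_le_mul_of_nonneg_right (hle j) (hy j)).trans h1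

/-- The cone over `Γ(f)` meets the open orthant if and only if every variable occurs in `f`. -/
theorem coneOf_inter_openOrthant_nonempty_iff (hn : 0 < n) (f : Fin m → MvPolynomial (Fin n) ℝ) :
    (coneOf (newtonPolyhedron f) ∩ openOrthant n).Nonempty ↔
      ∀ j, ∃ α ∈ exponents f, α j ≠ 0 := by
  constructor
  · rintro ⟨_, ⟨c, hc, x, hx, rfl⟩, hpos⟩ j
    by_contra hcon
    push Not at hcon
    have hx0 : x j = 0 := by
      rw [newtonPolyhedron_eq] at hx
      refine convexHull_min (t := {v : Fin n → ℝ | v j = 0}) ?_ ?_ hx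
      · rintro _ ⟨α, hα, rfl⟩
        simpa [expVec] using hcon α hα
      · exact convex_hyperplane
          (LinearMap.proj (R := ℝ) (φ := fun _ : Fin n => ℝ) j).isLinear 0
    have := hpos j
    simp [hx0] at this
  · intro h
    obtain ⟨α₀, hα₀, _⟩ := h ⟨0, hn⟩
    have hcard : 0 < ((exponents f).card : ℝ) := by exact_mod_cast Finset.card_pos.2 ⟨α₀, hα₀⟩
    have hx : ∑ α ∈ exponents f, ((exponents f).card : ℝ)⁻¹ • expVec α ∈ newtonPolyhedron f := by
      refine (convex_convexHull ℝ _).sum_mem (fun _ _ => by positivity) ?_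
        fun α hα => expVec_mem_newtonPolyhedron hα
      rw [Finset.sum_const, nsmul_eq_mul, mul_inv_cancel₀ hcard.ne']
    refine ⟨_, ⟨1, zero_le_one, _, hx, rfl⟩, fun j => ?_⟩
    obtain ⟨α, hα, hαj⟩ := h j
    rw [one_smul, Finset.sum_apply]
    refine Finset.sum_pos' (fun α _ => ?_) ⟨α, hα, ?_⟩
    · simp only [Pi.smul_apply, smul_eq_mul, expVec]; positivity
    · have : 0 < (α j : ℝ) := by exact_mod_cast Nat.pos_of_ne_zero hαj
      simp only [Pi.smul_apply, smul_eq_mul, expVec]; positivity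

theorem exists_isFurthestDiagonal (hn : 0 < n) {f : Fin m → MvPolynomial (Fin n) ℝ}
    (hpos : (coneOf (newtonPolyhedron f) ∩ openOrthant n).Nonempty) :
    ∃ d, IsFurthestDiagonal (completeNewtonPolyhedron f) d := by
  obtain ⟨V, hV⟩ := exists_completeNewtonPolyhedron_eq_convexHull f
  have hK : IsCompact (completeNewtonPolyhedron f) := by
    rw [hV]; exact V.finite_toSet.isCompact_convexHull ℝ
  obtain ⟨_, ⟨c, hc, x, hx, rfl⟩, hcx⟩ := hpos
  have hxpos : ∀ j, 0 < x j := by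
    intro j
    have := hcx j
    simp only [Pi.smul_apply, smul_eq_mul] at this
    exact pos_of_mul_pos_right this hc
  obtain ⟨j₀, -, hj₀⟩ := Finset.exists_min_image Finset.univ x ⟨⟨0, hn⟩, Finset.mem_univ _⟩
  have ht₀ : (fun _ => x j₀) ∈ completeNewtonPolyhedron f :=
    mem_completeNewtonPolyhedron.2 ⟨fun _ => (hxpos j₀).le, x, hx, fun j => hj₀ j (Finset.mem_univ j)⟩
  let A : Set ℝ := {t | (fun _ => t : Fin n → ℝ) ∈ completeNewtonPolyhedron f}
  have hA : IsCompact A := by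
    refine (hK.image (continuous_apply (⟨0, hn⟩ : Fin n))).of_isClosed_subset
      (hK.isClosed.preimage (by fun_prop)) fun t ht => ⟨_, ht, rfl⟩
  obtain ⟨d, hd, hmax⟩ := hA.exists_isGreatest ⟨_, ht₀⟩
  exact ⟨d, ⟨(hxpos j₀).trans_le (hmax ht₀), hd⟩, fun t ht => hmax ht.2⟩

/-- Every linear functional on `ℝⁿ` is a dot product. -/
theorem linearMap_apply_eq_dotProduct (l : (Fin n → ℝ) →ₗ[ℝ] ℝ) (x : Fin n → ℝ) :
    l x = x ⬝ᵥ fun j => l (Pi.single j 1) := by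
  conv_lhs => rw [pi_eq_sum_univ' x]
  simp only [map_sum, map_smul, smul_eq_mul, dotProduct]

theorem dotProduct_eq_zero_of_mem_span {s : Set (Fin n → ℝ)} {z x : Fin n → ℝ}
    (h : ∀ v ∈ s, v ⬝ᵥ z = 0) (hx : x ∈ Submodule.span ℝ s) : x ⬝ᵥ z = 0 := by
  induction hx using Submodule.span_induction with
  | mem y hy => exact h y hy
  | zero => simp
  | add x y _ _ hx hy => rw [add_dotProduct, hx, hy, add_zero]
  | smul c x _ hx => rw [smul_dotProduct, hx, smul_zero]

/-- The supporting hyperplane `{x | x ⬝ u = 1}` of the polytope `conv V` exposes the convex hull of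
the vertices on it. -/
theorem face_subset_convexHull {V : Finset (Fin n → ℝ)} {u : Fin n → ℝ}
    (hu : ∀ v ∈ V, v ⬝ᵥ u ≤ 1) :
    {x ∈ convexHull ℝ (V : Set (Fin n → ℝ)) | x ⬝ᵥ u = 1} ⊆
      convexHull ℝ ((V.filter fun v => v ⬝ᵥ u = 1 : Finset _) : Set (Fin n → ℝ)) := by
  rintro p ⟨hp, hpu⟩
  obtain ⟨μ, hμ0, hμ1, hμp⟩ := Finset.mem_convexHull'.1 hp
  have hμz : ∀ v ∈ V, v ⬝ᵥ u ≠ 1 → μ v = 0 := by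
    have h1 : ∑ v ∈ V, μ v * (1 - v ⬝ᵥ u) = 0 := by
      have := congrArg (fun x => x ⬝ᵥ u) hμp
      simp only [sum_dotProduct, smul_dotProduct, smul_eq_mul] at this
      simp only [mul_sub, Finset.sum_sub_distrib, mul_one, hμ1, this, hpu, sub_self]
    rw [Finset.sum_eq_zero_iff_of_nonneg
      (fun v hv => mul_nonneg (hμ0 v hv) (sub_nonneg.2 (hu v hv)))] at h1
    intro v hv hne
    rcases mul_eq_zero.1 (h1 v hv) with h | h
    · exact h
    · exact absurd (by linarith) hne
  rw [Finset.mem_convexHull']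
  refine ⟨μ, fun v hv => hμ0 v (Finset.mem_filter.1 hv).1, ?_, ?_⟩
  · refine (Finset.sum_subset (Finset.filter_subset _ _) fun v hv hvn => ?_).trans hμ1
    refine hμz v hv fun h => ?_
    exact hvn (Finset.mem_filter.2 ⟨hv, h⟩)
  · rw [← hμp]
    refine Finset.sum_subset (Finset.filter_subset _ _) fun v hv hvn => ?_
    rw [hμz v hv fun h => hvn (Finset.mem_filter.2 ⟨hv, h⟩), zero_smul]

/-- The polytope `Γ̃(f) = conv V` and its supporting hyperplane `{x | x ⬝ u = 1}` through the
furthest diagonal point `(d, …, d)`, in strictly complementary position: that point is the convex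
combination, with weights `w`, of exactly the vertices lying on the hyperplane. The finite set `V`
may contain points that are not vertices. The normal `u` is a point of the polar polytope
`{u ≥ 0 | ∀ x ∈ Γ̃(f), x ⬝ u ≤ 1}` where the coordinate sum takes its maximal value `1 / d`. -/
structure DiagonalSupport (f : Fin m → MvPolynomial (Fin n) ℝ) (d : ℝ) where
  V : Finset (Fin n → ℝ)
  u : Fin n → ℝ
  w : (Fin n → ℝ) → ℝ
  d_pos : 0 < d
  hull_eq : completeNewtonPolyhedron f = convexHull ℝ (V : Set (Fin n → ℝ))
  u_nonneg : ∀ j, 0 ≤ u j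
  le_one : ∀ v ∈ V, v ⬝ᵥ u ≤ 1
  w_nonneg : ∀ v ∈ V, 0 ≤ w v
  w_pos_iff : ∀ v ∈ V, v ⬝ᵥ u = 1 ↔ 0 < w v
  sum_w : ∑ v ∈ V, w v = 1
  sum_w_smul : ∑ v ∈ V, w v • v = fun _ => d

namespace DiagonalSupport

variable {f : Fin m → MvPolynomial (Fin n) ℝ} {d : ℝ} (P : DiagonalSupport f d)

/-- The vertices on the supporting hyperplane. -/
noncomputable def active : Finset (Fin n → ℝ) := P.V.filter fun v => v ⬝ᵥ P.u = 1

/-- The face of `Γ̃(f)` cut out by the supporting hyperplane. -/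
def face : Set (Fin n → ℝ) := {x ∈ completeNewtonPolyhedron f | x ⬝ᵥ P.u = 1}

theorem diagonal_mem (P : DiagonalSupport f d) : (fun _ => d) ∈ completeNewtonPolyhedron f := by
  rw [P.hull_eq, Finset.mem_convexHull']
  exact ⟨P.w, P.w_nonneg, P.sum_w, P.sum_w_smul⟩

theorem mem_of_mem_V {v : Fin n → ℝ} (hv : v ∈ P.V) : v ∈ completeNewtonPolyhedron f := by
  rw [P.hull_eq]; exact subset_convexHull ℝ _ hv

theorem dotProduct_u_le_one {x : Fin n → ℝ} (hx : x ∈ completeNewtonPolyhedron f) :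
    x ⬝ᵥ P.u ≤ 1 := by
  rw [P.hull_eq] at hx
  exact convexHull_min (t := {v : Fin n → ℝ | v ⬝ᵥ P.u ≤ 1}) P.le_one
    (convex_halfSpace_le ⟨fun v w => add_dotProduct v w _, fun c v => smul_dotProduct c v _⟩ 1) hx

theorem w_eq_zero {v : Fin n → ℝ} (hv : v ∈ P.V) (h : v ⬝ᵥ P.u ≠ 1) : P.w v = 0 :=
  ((P.w_nonneg v hv).eq_or_lt.resolve_right fun h0 => h ((P.w_pos_iff v hv).2 h0)).symm

theorem diagonal_dotProduct (y : Fin n → ℝ) :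
    d * ∑ j, y j = ∑ v ∈ P.V, P.w v * (v ⬝ᵥ y) := by
  have := congrArg (fun x => x ⬝ᵥ y) P.sum_w_smul
  simp only [sum_dotProduct, smul_dotProduct, smul_eq_mul] at this
  rw [this, dotProduct, Finset.mul_sum]

theorem diagonal_dotProduct_u : d * ∑ j, P.u j = 1 := by
  rw [P.diagonal_dotProduct, ← P.sum_w]
  refine Finset.sum_congr rfl fun v hv => ?_
  by_cases h : v ⬝ᵥ P.u = 1
  · rw [h, mul_one]
  · rw [P.w_eq_zero hv h, zero_mul]

theorem diagonal_mem_face : (fun _ => d) ∈ P.face := by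
  refine ⟨P.diagonal_mem, ?_⟩
  rw [dotProduct, ← Finset.mul_sum, P.diagonal_dotProduct_u]

theorem face_subset_span : P.face ⊆ Submodule.span ℝ (P.active : Set (Fin n → ℝ)) := by
  rintro x ⟨hx, hxu⟩
  rw [P.hull_eq] at hx
  exact convexHull_min Submodule.subset_span (Submodule.convex _) (face_subset_convexHull P.le_one ⟨hx, hxu⟩)

theorem active_subset_face : (P.active : Set (Fin n → ℝ)) ⊆ P.face := by
  intro v hv
  obtain ⟨h1, h2⟩ := Finset.mem_filter.1 hv
  exact ⟨P.mem_of_mem_V h1, h2⟩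

theorem isFace_face : IsFace (completeNewtonPolyhedron f) P.face := by
  refine ⟨⟨_, P.diagonal_mem_face⟩, fun _ => ?_⟩
  let l : (Fin n → ℝ) →ₗ[ℝ] ℝ :=
    { toFun := fun v => v ⬝ᵥ P.u
      map_add' := fun v w => add_dotProduct v w P.u
      map_smul' := fun c v => smul_dotProduct c v P.u }
  refine ⟨l.toContinuousLinearMap, ?_⟩
  ext x
  constructor
  · rintro ⟨hx, hxu⟩
    refine ⟨hx, fun y hy => ?_⟩
    change y ⬝ᵥ P.u ≤ x ⬝ᵥ P.u
    rw [hxu]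
    exact P.dotProduct_u_le_one hy
  · rintro ⟨hx, hmax⟩
    refine ⟨hx, le_antisymm (P.dotProduct_u_le_one hx) ?_⟩
    rw [← P.diagonal_mem_face.2]
    exact hmax _ P.diagonal_mem

theorem diagonal_mem_intrinsicInterior_face : (fun _ => d) ∈ intrinsicInterior ℝ P.face := by
  let l : (Fin n → ℝ) →ₗ[ℝ] ℝ :=
    { toFun := fun v => v ⬝ᵥ P.u
      map_add' := fun v w => add_dotProduct v w P.u
      map_smul' := fun c v => smul_dotProduct c v P.u }
  have hlD : l (fun _ => d) = 1 := P.diagonal_mem_face.2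
  have := mem_intrinsicInterior_face P.V (l := l) (w := P.w) (D := fun _ => d)
    (by rw [hlD]; exact P.le_one) P.w_nonneg (by rw [hlD]; exact P.w_pos_iff) P.sum_w P.sum_w_smul
  rw [hlD, ← P.hull_eq] at this
  exact this

/-- Every face with the diagonal point in its relative interior is `P.face`. -/
theorem isSmallestFaceAt_face :
    IsSmallestFaceAt (completeNewtonPolyhedron f) (fun _ => d) P.face := by
  refine ⟨⟨P.isFace_face, P.diagonal_mem_intrinsicInterior_face⟩, fun Λ' hΛ' hD => ?_⟩
  have h1 := IsExposed.subset_of_mem_intrinsicInterior P.isFace_face.2 hΛ'.2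
    P.diagonal_mem_intrinsicInterior_face (intrinsicInterior_subset hD)
  exact Submodule.finrank_mono (vectorSpan_mono ℝ h1)

theorem dim_face_add_one :
    dim P.face + 1 = Module.finrank ℝ (Submodule.span ℝ (P.active : Set (Fin n → ℝ))) := by
  set D : Fin n → ℝ := fun _ => d with hDdef
  have hD := P.diagonal_mem_face
  have hsup : vectorSpan ℝ P.face ⊔ Submodule.span ℝ {D} =
      Submodule.span ℝ (P.active : Set (Fin n → ℝ)) := by
    apply le_antisymm
    · refine sup_le ?_ ?_
      · rw [vectorSpan_def, Submodule.span_le]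
        rintro _ ⟨x, hx, y, hy, rfl⟩
        exact Submodule.sub_mem _ (P.face_subset_span hx) (P.face_subset_span hy)
      · rw [Submodule.span_singleton_le_iff_mem]
        exact P.face_subset_span hD
    · rw [Submodule.span_le]
      intro v hv
      have h1 : v - D ∈ vectorSpan ℝ P.face :=
        vsub_mem_vectorSpan ℝ (P.active_subset_face hv) hD
      have := Submodule.add_mem_sup h1 (Submodule.mem_span_singleton_self (R := ℝ) D)
      rwa [sub_add_cancel] at this
  have hker : ∀ x ∈ vectorSpan ℝ P.face, x ⬝ᵥ P.u = 0 := by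
    intro x hx
    refine dotProduct_eq_zero_of_mem_span ?_ hx
    rintro _ ⟨y, hy, z, hz, rfl⟩
    simp only [vsub_eq_sub, sub_dotProduct, hy.2, hz.2, sub_self]
  have hinf : vectorSpan ℝ P.face ⊓ Submodule.span ℝ {D} = ⊥ := by
    rw [eq_bot_iff]
    rintro x ⟨hx, hxD⟩
    obtain ⟨c, rfl⟩ := Submodule.mem_span_singleton.1 hxD
    have := hker _ hx
    rw [smul_dotProduct, hD.2, smul_eq_mul, mul_one] at this
    simp [this]
  have hne : D ≠ 0 := by
    intro h
    have := hD.2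
    rw [← hDdef, h, zero_dotProduct] at this
    exact zero_ne_one this
  have := Submodule.finrank_sup_add_finrank_inf_eq (vectorSpan ℝ P.face) (Submodule.span ℝ {D})
  rw [hsup, hinf, finrank_bot, add_zero, finrank_span_singleton hne] at this
  exact this.symm

theorem dim_face_lt : dim P.face < n := by
  have := (Submodule.span ℝ (P.active : Set (Fin n → ℝ))).finrank_le
  rw [← P.dim_face_add_one, Module.finrank_fin_fun] at this
  omega

/-- The defining inequality `v ⬝ y ≤ T` of the polar polytope, combined along `P.w`, bounds the
coordinate sum by `T / d` with a gain for each slack `T - b ⬝ y` of an active vertex `b`. -/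
theorem sum_le_of_dotProduct_le {B : Finset (Fin n → ℝ)} (hB : B ⊆ P.active) {y : Fin n → ℝ} {T : ℝ}
    (hy : ∀ v ∈ completeNewtonPolyhedron f, v ⬝ᵥ y ≤ T) :
    ∑ j, y j ≤ (1 / d) * (T - ∑ b ∈ B, P.w b * (T - b ⬝ᵥ y)) := by
  have h1 := P.diagonal_dotProduct y
  have h2 : ∑ b ∈ B, P.w b * (T - b ⬝ᵥ y) ≤ ∑ v ∈ P.V, P.w v * (T - v ⬝ᵥ y) :=
    Finset.sum_le_sum_of_subset_of_nonneg (hB.trans (Finset.filter_subset _ _)) fun v hv _ =>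
      mul_nonneg (P.w_nonneg v hv) (sub_nonneg.2 (hy v (P.mem_of_mem_V hv)))
  have h3 : ∑ v ∈ P.V, P.w v * (T - v ⬝ᵥ y) = T - d * ∑ j, y j := by
    simp only [mul_sub, Finset.sum_sub_distrib, ← Finset.sum_mul, P.sum_w, h1, one_mul]
  have hd := P.d_pos
  rw [one_div, ← div_eq_inv_mul, le_div_iff₀ hd]
  linarith

/-- Some active vertices together with some coordinate vectors form a basis of `ℝⁿ`, the number of
active vertices in it being `dim P.face + 1`. -/
theorem exists_basis_active : ∃ B C : Finset (Fin n → ℝ), B ⊆ C ∧ B ⊆ P.active ∧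
    B.card = dim P.face + 1 ∧ C.card = n ∧ (∀ c ∈ C, c ∉ B → ∃ j, c = Pi.single j 1) ∧
    ∀ x : Fin n → ℝ, (∀ c ∈ C, c ⬝ᵥ x = 0) → x = 0 := by
  classical
  obtain ⟨B, hBs, hBspan, hBli⟩ := exists_linearIndependent ℝ (P.active : Set (Fin n → ℝ))
  let e : Set (Fin n → ℝ) := Set.range fun j : Fin n => Pi.single j 1
  obtain ⟨C, hCs, hBC, hCspan, hCli⟩ := exists_linearIndepOn_id_extension (s := B) (t := B ∪ e)
    hBli Set.subset_union_left
  have hBfin : B.Finite := P.active.finite_toSet.subset hBs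
  have hCfin : C.Finite := (hBfin.union (Set.finite_range _)).subset hCs
  have hx : ∀ x : Fin n → ℝ, (∀ c ∈ C, c ⬝ᵥ x = 0) → x = 0 := by
    intro x hx
    have h0 : ∀ y ∈ Submodule.span ℝ C, y ⬝ᵥ x = 0 := by
      exact fun y hy => dotProduct_eq_zero_of_mem_span hx hy
    ext j
    simpa using h0 _ (hCspan (Or.inr ⟨j, rfl⟩))
  have hCtop : Submodule.span ℝ C = ⊤ := by
    rw [eq_top_iff, ← (Pi.basisFun ℝ (Fin n)).span_eq]
    refine Submodule.span_le.2 ?_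
    rintro _ ⟨j, rfl⟩
    rw [Pi.basisFun_apply]
    exact hCspan (Or.inr ⟨j, rfl⟩)
  refine ⟨hBfin.toFinset, hCfin.toFinset, by simpa using hBC, by simpa [← Finset.coe_subset] using hBs,
    ?_, ?_, ?_, ?_⟩
  · rw [P.dim_face_add_one, ← hBspan]
    have : Fintype B := hBfin.fintype
    rw [finrank_span_set_eq_card hBli]
    simp
  · have : Fintype C := hCfin.fintype
    have h1 := finrank_span_set_eq_card hCli
    rw [hCtop, finrank_top, Module.finrank_fin_fun] at h1
    have h2 : hCfin.toFinset = C.toFinset := by ext; simp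
    exact (congrArg Finset.card h2).trans h1.symm
  · intro c hc hcB
    rw [Set.Finite.mem_toFinset] at hc hcB
    rcases hCs hc with h | ⟨j, rfl⟩
    · exact absurd h hcB
    · exact ⟨j, rfl⟩
  · simpa using hx

/-- The face of the polar polytope dual to `P.face` has dimension at least `n - 1 - dim P.face`:
it contains `P.u` together with its translates by that many independent vectors. -/
theorem exists_dual_directions : ∃ z : Fin (n - 1 - dim P.face) → Fin n → ℝ,
    LinearIndependent ℝ z ∧ (∀ i j, 0 ≤ P.u j + z i j) ∧
    (∀ i, ∀ v ∈ completeNewtonPolyhedron f, v ⬝ᵥ (P.u + z i) ≤ 1) ∧ ∀ i, ∑ j, z i j = 0 := by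
  classical
  let A : Matrix P.active (Fin n) ℝ := Matrix.of fun v => v.1
  have hrank : A.rank = dim P.face + 1 := by
    have hrange : Set.range A.row = (P.active : Set (Fin n → ℝ)) := Subtype.range_coe
    rw [Matrix.rank_eq_finrank_span_row, P.dim_face_add_one, hrange]
  have hker : Module.finrank ℝ (LinearMap.ker A.mulVecLin) = n - 1 - dim P.face := by
    have := A.mulVecLin.finrank_range_add_finrank_ker
    rw [Module.finrank_fin_fun] at this
    have h2 : Module.finrank ℝ (LinearMap.range A.mulVecLin) = dim P.face + 1 := hrank
    omega
  let bas := Module.finBasisOfFinrankEq ℝ (LinearMap.ker A.mulVecLin) hker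
  let z₀ : Fin (n - 1 - dim P.face) → Fin n → ℝ := fun i => bas i
  have hz₀li : LinearIndependent ℝ z₀ :=
    bas.linearIndependent.map' (Submodule.subtype _) (Submodule.ker_subtype _)
  have hz₀act : ∀ i, ∀ v ∈ P.active, v ⬝ᵥ z₀ i = 0 := by
    intro i v hv
    have := (bas i).2
    rw [LinearMap.mem_ker, Matrix.mulVecLin_apply] at this
    exact congrFun this ⟨v, hv⟩
  have hz₀span : ∀ i, ∀ x ∈ P.face, x ⬝ᵥ z₀ i = 0 := by
    exact fun i x hx => dotProduct_eq_zero_of_mem_span (hz₀act i) (P.face_subset_span hx)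
  -- where `P.u` vanishes, the face is stable under decreasing the coordinate
  have hz₀zero : ∀ i j, P.u j = 0 → z₀ i j = 0 := by
    intro i j hj
    have hD := P.diagonal_mem_face
    have h1 : (fun _ => d) - Pi.single j d ∈ P.face := by
      refine ⟨completeNewtonPolyhedron_of_le P.diagonal_mem (fun k => ?_) fun k => ?_, ?_⟩
      · by_cases hk : k = j
        · subst hk; simp
        · simp [hk, P.d_pos.le]
      · by_cases hk : k = j
        · subst hk; simp [P.d_pos.le]
        · simp [hk]
      · rw [sub_dotProduct, hD.2, single_dotProduct, hj, mul_zero, sub_zero]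
    have h2 := hz₀span i _ h1
    rw [sub_dotProduct, hz₀span i _ hD, single_dotProduct, zero_sub, neg_eq_zero] at h2
    exact (mul_eq_zero.1 h2).resolve_left P.d_pos.ne'
  have hsmall : ∀ a b : ℝ, 0 < a → ∀ᶠ ε : ℝ in 𝓝[>] 0, 0 ≤ a + ε * b := by
    intro a b ha
    have hc : ContinuousAt (fun ε : ℝ => a + ε * b) 0 := by fun_prop
    have := hc.tendsto.eventually (Ioi_mem_nhds (show (0 : ℝ) < a + 0 * b by simpa using ha))
    filter_upwards [nhdsWithin_le_nhds this] with ε hε using le_of_lt hε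
  have hev : ∀ᶠ ε : ℝ in 𝓝[>] 0, (∀ i j, 0 ≤ P.u j + ε * z₀ i j) ∧
      ∀ i, ∀ v ∈ P.V, 0 ≤ (1 - v ⬝ᵥ P.u) + ε * -(v ⬝ᵥ z₀ i) := by
    refine (eventually_all.2 fun i => eventually_all.2 fun j => ?_).and
      (eventually_all.2 fun i => (Finset.eventually_all _).2 fun v hv => ?_)
    · rcases (P.u_nonneg j).eq_or_lt with h | h
      · simp [← h, hz₀zero i j h.symm]
      · exact hsmall _ _ h
    · rcases (P.le_one v hv).eq_or_lt with h | h
      · simp [h, hz₀act i v (Finset.mem_filter.2 ⟨hv, h⟩)]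
      · exact hsmall _ _ (by linarith)
  obtain ⟨ε, ⟨h1, h2⟩, hε⟩ := (hev.and self_mem_nhdsWithin).exists
  have hε : (0 : ℝ) < ε := hε
  refine ⟨fun i => ε • z₀ i, ?_, h1, fun i => ?_, fun i => ?_⟩
  · exact hz₀li.units_smul fun _ => Units.mk0 ε hε.ne'
  · rw [P.hull_eq]
    refine convexHull_min (t := {v : Fin n → ℝ | v ⬝ᵥ (P.u + ε • z₀ i) ≤ 1}) (fun v hv => ?_)
      (convex_halfSpace_le ⟨fun v w => add_dotProduct v w _, fun c v => smul_dotProduct c v _⟩ 1)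
    have := h2 i v hv
    change v ⬝ᵥ (P.u + ε • z₀ i) ≤ 1
    rw [dotProduct_add, dotProduct_smul, smul_eq_mul]
    linarith
  · have := hz₀span i _ P.diagonal_mem_face
    rw [dotProduct, ← Finset.mul_sum] at this
    simp only [Pi.smul_apply, smul_eq_mul, ← Finset.mul_sum]
    rw [(mul_eq_zero.1 this).resolve_left P.d_pos.ne', mul_zero]

end DiagonalSupport

theorem exists_diagonalSupport {f : Fin m → MvPolynomial (Fin n) ℝ} {d : ℝ}
    (hd : IsFurthestDiagonal (completeNewtonPolyhedron f) d) : Nonempty (DiagonalSupport f d) := by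
  obtain ⟨⟨hd0, hdP⟩, hmax⟩ := hd
  obtain ⟨V, hV⟩ := exists_completeNewtonPolyhedron_eq_convexHull f
  obtain ⟨l, w, hl, hw0, hlw, hw1, hwD⟩ := exists_strictly_complementary V (hV ▸ hdP)
  set D : Fin n → ℝ := fun _ => d with hD
  have hlP : ∀ x ∈ completeNewtonPolyhedron f, l x ≤ l D := by
    rw [hV]
    exact convexHull_min (t := {x | l x ≤ l D}) hl (convex_halfSpace_le l.isLinear _)
  have h0P : (0 : Fin n → ℝ) ∈ completeNewtonPolyhedron f :=
    completeNewtonPolyhedron_of_le hdP (fun _ => le_rfl) fun _ => hd0.le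
  -- were `0` on the hyperplane, the segment from `0` to `D` could be prolonged inside the face
  have hM : 0 < l D := by
    have hM0 := hlP 0 h0P
    rw [map_zero] at hM0
    refine lt_of_le_of_ne hM0 fun h => ?_
    have hrel := mem_intrinsicInterior_face V hl hw0 hlw hw1 hwD
    rw [← hV] at hrel
    obtain ⟨ε, hε, hz, _⟩ := exists_prolong_of_mem_intrinsicInterior hrel
      (subset_affineSpan ℝ _ (⟨h0P, by rw [map_zero, h]⟩ :
        (0 : Fin n → ℝ) ∈ {x ∈ completeNewtonPolyhedron f | l x = l D}))
    have h1 : D + ε • (D - 0) = fun _ => d + ε * d := by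
      ext; simp [hD]
    rw [h1] at hz
    have := hmax ⟨by positivity, hz⟩
    nlinarith
  set u : Fin n → ℝ := fun j => l (Pi.single j 1) / l D with hu
  have hlu : ∀ x, x ⬝ᵥ u = l x / l D := by
    intro x
    rw [linearMap_apply_eq_dotProduct l x]
    simp only [hu, dotProduct, Finset.sum_div, mul_div_assoc]
  refine ⟨⟨V, u, w, hd0, hV, fun j => ?_, fun v hv => ?_, hw0, fun v hv => ?_, hw1, hwD⟩⟩
  · have h1 : D - Pi.single j d ∈ completeNewtonPolyhedron f := by
      refine completeNewtonPolyhedron_of_le hdP (fun k => ?_) fun k => ?_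
      · by_cases hk : k = j
        · subst hk; simp [hD]
        · simp [hk, hd0.le, hD]
      · by_cases hk : k = j
        · subst hk; simp [hd0.le, hD]
        · simp [hk, hD]
    have h2 := hlP _ h1
    have h3 : Pi.single j d = d • (Pi.single j 1 : Fin n → ℝ) := by
      rw [← Pi.single_smul, smul_eq_mul, mul_one]
    rw [map_sub, h3, map_smul, smul_eq_mul] at h2
    have h4 : 0 ≤ d * l (Pi.single j 1) := by linarith
    exact div_nonneg (nonneg_of_mul_nonneg_right h4 hd0) hM.le
  · rw [hlu, div_le_one hM]
    exact hl v hv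
  · rw [hlu, div_eq_one_iff_eq hM.ne']
    exact hlw v hv

/-! ### Lattice points of the dilated polar polytope -/

/-- If finitely many linear forms have no nonzero common zero, then a set of lattice points on which
each of them varies by at most one is of bounded cardinality. -/
theorem exists_card_le_of_dotProduct_sub_le {ι : Type*} [Fintype ι] (β : ι → Fin n → ℝ)
    (hβ : ∀ x : Fin n → ℝ, (∀ i, β i ⬝ᵥ x = 0) → x = 0) :
    ∃ K : ℕ, ∀ U : Finset (Fin n → ℕ),
      (∀ u ∈ U, ∀ u' ∈ U, ∀ i, |β i ⬝ᵥ (fun j => (u j : ℝ)) - β i ⬝ᵥ (fun j => (u' j : ℝ))| ≤ 1) →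
      U.card ≤ K := by
  let L : (Fin n → ℝ) →ₗ[ℝ] (ι → ℝ) :=
    { toFun := fun x i => β i ⬝ᵥ x
      map_add' := fun x y => by ext i; simp [dotProduct_add]
      map_smul' := fun c x => by ext i; simp [dotProduct_smul] }
  have hL : LinearMap.ker L = ⊥ := by
    rw [LinearMap.ker_eq_bot']
    exact fun x hx => hβ x fun i => congrFun hx i
  obtain ⟨K, hK0, hK⟩ := L.exists_antilipschitzWith hL
  obtain ⟨N, hN⟩ := exists_nat_ge (K : ℝ)
  refine ⟨(2 * N + 1) ^ n, fun U hU => ?_⟩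
  rcases U.eq_empty_or_nonempty with rfl | ⟨u₀, hu₀⟩
  · simp
  have hsub : U ⊆ Fintype.piFinset fun j => Finset.Icc (u₀ j - N) (u₀ j + N) := by
    intro u hu
    rw [Fintype.mem_piFinset]
    intro j
    have h1 := hK.le_mul_dist (fun j => (u j : ℝ)) (fun j => (u₀ j : ℝ))
    have h2 : dist (L fun j => (u j : ℝ)) (L fun j => (u₀ j : ℝ)) ≤ 1 := by
      rw [dist_pi_le_iff zero_le_one]
      exact fun i => hU u hu u₀ hu₀ i
    have h3 : |(u j : ℝ) - u₀ j| ≤ N := by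
      refine (dist_le_pi_dist (fun j => (u j : ℝ)) (fun j => (u₀ j : ℝ)) j).trans (h1.trans ?_)
      exact (mul_le_of_le_one_right K.2 h2).trans hN
    rw [abs_le] at h3
    have h4 : (u₀ j : ℝ) ≤ u j + N := by linarith
    have h5 : (u j : ℝ) ≤ u₀ j + N := by linarith
    have h4 : u₀ j ≤ u j + N := by exact_mod_cast h4
    have h5 : u j ≤ u₀ j + N := by exact_mod_cast h5
    rw [Finset.mem_Icc]
    omega
  refine (Finset.card_le_card hsub).trans ?_
  rw [Fintype.card_piFinset]
  calc ∏ j, (Finset.Icc (u₀ j - N) (u₀ j + N)).card ≤ ∏ _j : Fin n, (2 * N + 1) :=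
        Finset.prod_le_prod' fun j _ => by rw [Nat.card_Icc]; omega
    _ = _ := by simp

/-- A sum over lattice points of a product of powers, whose exponents are the integer parts of
affine forms whose linear parts have no nonzero common zero, is bounded by a product of geometric sums. -/
theorem exists_sum_prod_pow_floor_le {ι : Type*} [Fintype ι] (β : ι → Fin n → ℝ)
    (hβ : ∀ x : Fin n → ℝ, (∀ i, β i ⬝ᵥ x = 0) → x = 0) :
    ∃ K : ℝ, 0 < K ∧ ∀ (c ρ : ι → ℝ) (N : ℕ) (U : Finset (Fin n → ℕ)), (∀ i, 0 ≤ ρ i) →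
      (∀ u ∈ U, ∀ i, 0 ≤ c i + β i ⬝ᵥ (fun j => (u j : ℝ)) ∧
        c i + β i ⬝ᵥ (fun j => (u j : ℝ)) < N) →
      ∑ u ∈ U, ∏ i, ρ i ^ ⌊c i + β i ⬝ᵥ (fun j => (u j : ℝ))⌋₊ ≤
        K * ∏ i, ∑ s ∈ Finset.range N, ρ i ^ s := by
  classical
  obtain ⟨K, hK⟩ := exists_card_le_of_dotProduct_sub_le β hβ
  refine ⟨K + 1, by positivity, fun c ρ N U hρ hU => ?_⟩
  set φ : (Fin n → ℕ) → ι → ℕ := fun u i => ⌊c i + β i ⬝ᵥ (fun j => (u j : ℝ))⌋₊ with hφ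
  have hmaps : ∀ u ∈ U, φ u ∈ Fintype.piFinset fun _ : ι => Finset.range N := by
    intro u hu
    rw [Fintype.mem_piFinset]
    exact fun i => Finset.mem_range.2 ((Nat.floor_lt (hU u hu i).1).2 (hU u hu i).2)
  rw [Finset.prod_univ_sum, Finset.mul_sum, ← Finset.sum_fiberwise_of_maps_to hmaps]
  refine Finset.sum_le_sum fun y _ => ?_
  have h1 : ∑ u ∈ U with φ u = y, ∏ i, ρ i ^ φ u i = (U.filter fun u => φ u = y).card •
      ∏ i, ρ i ^ y i := by
    rw [← Finset.sum_const]
    exact Finset.sum_congr rfl fun u hu => by rw [(Finset.mem_filter.1 hu).2]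
  have h2 : (U.filter fun u => φ u = y).card ≤ K := by
    refine hK _ fun u hu u' hu' i => ?_
    obtain ⟨hu, hφu⟩ := Finset.mem_filter.1 hu
    obtain ⟨hu', hφu'⟩ := Finset.mem_filter.1 hu'
    have e1 := congrFun hφu i
    have e2 := congrFun hφu' i
    have a1 := Nat.floor_le (hU u hu i).1
    have a2 := Nat.lt_floor_add_one (c i + β i ⬝ᵥ (fun j => (u j : ℝ)))
    have b1 := Nat.floor_le (hU u' hu' i).1
    have b2 := Nat.lt_floor_add_one (c i + β i ⬝ᵥ (fun j => (u' j : ℝ)))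
    simp only [hφ] at e1 e2
    rw [e1] at a1 a2
    rw [e2] at b1 b2
    rw [abs_le]
    constructor <;> linarith
  have h3 : ((U.filter fun u => φ u = y).card : ℝ) ≤ K := by exact_mod_cast h2
  have h4 : 0 ≤ ∏ i, ρ i ^ y i := Finset.prod_nonneg fun i _ => pow_nonneg (hρ i) _
  change ∑ u ∈ U with φ u = y, ∏ i, ρ i ^ φ u i ≤ _
  rw [h1, nsmul_eq_mul]
  exact mul_le_mul_of_nonneg_right (by linarith) h4

namespace DiagonalSupport

variable {f : Fin m → MvPolynomial (Fin n) ℝ} {d : ℝ} (P : DiagonalSupport f d)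

/-- The sum of `2 ^ (u₁ + ⋯ + uₙ)` over the lattice points of the dilated polar polytope is of
order at most `2 ^ (T / d) * T ^ (n - 1 - dim P.face)`. -/
theorem exists_sum_two_pow_le (hvar : ∀ j, ∃ α ∈ exponents f, α j ≠ 0) :
    ∃ K : ℝ, 0 < K ∧ ∀ T : ℝ, 1 ≤ T → ∀ U : Finset (Fin n → ℕ),
      (∀ u ∈ U, ∀ α ∈ exponents f, expVec α ⬝ᵥ (fun j => (u j : ℝ)) ≤ T) →
      ∑ u ∈ U, (2 : ℝ) ^ (∑ j, u j) ≤ K * ((2 : ℝ) ^ (T / d) * T ^ (n - 1 - dim P.face)) := by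
  classical
  obtain ⟨B, C, hBC, hBact, hBcard, hCcard, hCB, hC⟩ := P.exists_basis_active
  have hd := P.d_pos
  let β : C → Fin n → ℝ := fun b => if b.1 ∈ B then -b.1 else b.1
  have hβ : ∀ x : Fin n → ℝ, (∀ i, β i ⬝ᵥ x = 0) → x = 0 := by
    refine fun x hx => hC x fun b hb => ?_
    have := hx ⟨b, hb⟩
    simp only [β] at this
    split_ifs at this
    · simpa using this
    · exact this
  obtain ⟨K, hK0, hK⟩ := exists_sum_prod_pow_floor_le β hβ
  have hw : ∀ b ∈ B, 0 < P.w b := by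
    intro b hb
    obtain ⟨h1, h2⟩ := Finset.mem_filter.1 (hBact hb)
    exact (P.w_pos_iff b h1).1 h2
  let ρ' : (Fin n → ℝ) → ℝ := fun b => (2 : ℝ) ^ (-(P.w b / d))
  have hρ'0 : ∀ b, 0 < ρ' b := fun b => by positivity
  have hρ'1 : ∀ b ∈ B, ρ' b < 1 := fun b hb =>
    Real.rpow_lt_one_of_one_lt_of_neg one_lt_two (neg_lt_zero.2 (div_pos (hw b hb) hd))
  let G : ℝ := ∏ b ∈ B, (1 - ρ' b)⁻¹
  have hG : 0 < G := Finset.prod_pos fun b hb => inv_pos.2 (sub_pos.2 (hρ'1 b hb))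
  refine ⟨K * (2 ^ (n - 1 - dim P.face) * G), by positivity, fun T hT U hU => ?_⟩
  let N := ⌊T⌋₊ + 1
  have hTN : T < N := by simpa [N] using Nat.lt_floor_add_one T
  have hNT : (N : ℝ) ≤ 2 * T := by
    have := Nat.floor_le (show 0 ≤ T by linarith)
    simp only [N, Nat.cast_add, Nat.cast_one]
    linarith
  have hpoly : ∀ u ∈ U, ∀ v ∈ completeNewtonPolyhedron f, v ⬝ᵥ (fun j => (u j : ℝ)) ≤ T :=
    fun u hu v hv => dotProduct_le_of_mem_completeNewtonPolyhedron (fun _ => Nat.cast_nonneg _)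
      (hU u hu) hv
  let c : C → ℝ := fun b => if b.1 ∈ B then T else 0
  let ρ : C → ℝ := fun b => if b.1 ∈ B then ρ' b.1 else 1
  have hcond : ∀ u ∈ U, ∀ i, 0 ≤ c i + β i ⬝ᵥ (fun j => (u j : ℝ)) ∧
      c i + β i ⬝ᵥ (fun j => (u j : ℝ)) < N := by
    rintro u hu ⟨b, hb⟩
    by_cases hbB : b ∈ B
    · have hbP := P.mem_of_mem_V (Finset.mem_filter.1 (hBact hbB)).1
      have h1 := hpoly u hu b hbP
      have h2 : 0 ≤ b ⬝ᵥ (fun j => (u j : ℝ)) := Finset.sum_nonneg fun j _ =>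
        mul_nonneg ((mem_completeNewtonPolyhedron.1 hbP).1 j) (Nat.cast_nonneg _)
      simp only [c, β, hbB, if_true, neg_dotProduct]
      constructor <;> linarith
    · obtain ⟨j, rfl⟩ := hCB b hb hbB
      simp only [c, β, hbB, if_false, single_dotProduct, one_mul, zero_add]
      refine ⟨Nat.cast_nonneg _, lt_of_le_of_lt ?_ hTN⟩
      obtain ⟨α, hα, hαj⟩ := hvar j
      refine le_trans ?_ (hU u hu α hα)
      have h1 : (1 : ℝ) ≤ α j := by exact_mod_cast Nat.one_le_iff_ne_zero.2 hαj
      have h2 : expVec α j * (u j : ℝ) ≤ expVec α ⬝ᵥ (fun j => (u j : ℝ)) :=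
        Finset.single_le_sum (f := fun j => expVec α j * (u j : ℝ))
          (fun j _ => mul_nonneg (Nat.cast_nonneg _) (Nat.cast_nonneg _)) (Finset.mem_univ j)
      have h3 : (0 : ℝ) ≤ u j := Nat.cast_nonneg _
      simp only [expVec] at h2
      nlinarith
  have hmain := hK c ρ N U (fun i => by
    simp only [ρ]; split_ifs
    · exact (hρ'0 _).le
    · exact zero_le_one) hcond
  have hterm : ∀ u ∈ U, (2 : ℝ) ^ (∑ j, u j) ≤
      (2 : ℝ) ^ (T / d) * ∏ i, ρ i ^ ⌊c i + β i ⬝ᵥ (fun j => (u j : ℝ))⌋₊ := by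
    intro u hu
    have h1 := P.sum_le_of_dotProduct_le hBact (hpoly u hu)
    have h2 : ∏ i, ρ i ^ ⌊c i + β i ⬝ᵥ (fun j => (u j : ℝ))⌋₊ =
        ∏ b ∈ B, ρ' b ^ ⌊T - b ⬝ᵥ (fun j => (u j : ℝ))⌋₊ := by
      rw [Finset.prod_coe_sort C fun b => (if b ∈ B then ρ' b else 1) ^
        ⌊(if b ∈ B then T else 0) + (if b ∈ B then -b else b) ⬝ᵥ (fun j => (u j : ℝ))⌋₊,
        ← Finset.prod_sdiff hBC, Finset.prod_eq_one, one_mul]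
      · refine Finset.prod_congr rfl fun b hb => ?_
        simp only [hb, if_true, neg_dotProduct, sub_eq_add_neg]
      · intro b hb
        simp [(Finset.mem_sdiff.1 hb).2]
    have h3 : ∏ b ∈ B, (2 : ℝ) ^ (-(P.w b / d) * (T - b ⬝ᵥ (fun j => (u j : ℝ)))) ≤
        ∏ b ∈ B, ρ' b ^ ⌊T - b ⬝ᵥ (fun j => (u j : ℝ))⌋₊ := by
      refine Finset.prod_le_prod (fun b _ => by positivity) fun b hb => ?_
      have hs := hpoly u hu b (P.mem_of_mem_V (Finset.mem_filter.1 (hBact hb)).1)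
      rw [Real.rpow_mul zero_le_two, ← Real.rpow_natCast]
      exact Real.rpow_le_rpow_of_exponent_ge (hρ'0 b) (hρ'1 b hb).le
        (Nat.floor_le (by linarith))
    rw [h2]
    refine le_trans ?_ (mul_le_mul_of_nonneg_left h3 (by positivity))
    rw [← Real.rpow_sum_of_pos two_pos, ← Real.rpow_add two_pos, ← Real.rpow_natCast]
    refine Real.rpow_le_rpow_of_exponent_le one_le_two ?_
    push_cast
    refine h1.trans (le_of_eq ?_)
    rw [mul_sub, Finset.mul_sum, sub_eq_add_neg, ← Finset.sum_neg_distrib]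
    congr 1
    · ring
    · exact Finset.sum_congr rfl fun b _ => by ring
  have hgeom : ∀ b, 0 ≤ ∑ s ∈ Finset.range N, (if b ∈ B then ρ' b else 1) ^ s := by
    refine fun b => Finset.sum_nonneg fun s _ => pow_nonneg ?_ s
    split_ifs
    · exact (hρ'0 b).le
    · exact zero_le_one
  have hprod : ∏ i, ∑ s ∈ Finset.range N, ρ i ^ s ≤ (2 * T) ^ (n - 1 - dim P.face) * G := by
    rw [Finset.prod_coe_sort C fun b => ∑ s ∈ Finset.range N, (if b ∈ B then ρ' b else 1) ^ s,
      ← Finset.prod_sdiff hBC]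
    refine mul_le_mul ?_ ?_ ?_ (by positivity)
    · have hcard : (C \ B).card = n - 1 - dim P.face := by
        rw [Finset.card_sdiff_of_subset hBC, hBcard, hCcard]; omega
      rw [← hcard, ← Finset.prod_const]
      refine Finset.prod_le_prod (fun b _ => hgeom b) fun b hb => ?_
      · simp only [(Finset.mem_sdiff.1 hb).2, if_false, one_pow, Finset.sum_const,
          Finset.card_range, nsmul_eq_mul, mul_one]
        exact hNT
    · refine Finset.prod_le_prod (fun b _ => hgeom b) fun b hb => ?_
      · simp only [hb, if_true]
        rw [← tsum_geometric_of_lt_one (hρ'0 b).le (hρ'1 b hb)]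
        exact (summable_geometric_of_lt_one (hρ'0 b).le (hρ'1 b hb)).sum_le_tsum _
          fun s _ => pow_nonneg (hρ'0 b).le s
    · exact Finset.prod_nonneg fun b _ => hgeom b
  calc ∑ u ∈ U, (2 : ℝ) ^ (∑ j, u j)
      ≤ ∑ u ∈ U, (2 : ℝ) ^ (T / d) * ∏ i, ρ i ^ ⌊c i + β i ⬝ᵥ (fun j => (u j : ℝ))⌋₊ :=
        Finset.sum_le_sum hterm
    _ ≤ (2 : ℝ) ^ (T / d) * (K * ((2 * T) ^ (n - 1 - dim P.face) * G)) := by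
        rw [← Finset.mul_sum]
        gcongr
        exact hmain.trans (by gcongr)
    _ = _ := by rw [mul_pow]; ring

/-- The dilate by `T` of the polar polytope contains at least a constant times
`T ^ (n - 1 - dim P.face)` lattice points at bounded distance from its face where the coordinate sum
takes its maximum `T / d`. -/
theorem exists_lattice_points_near_dual_face :
    ∃ K : ℝ, 0 < K ∧ ∀ T : ℝ, 0 ≤ T → ∃ U : Finset (Fin n → ℕ),
      (∀ u ∈ U, (∀ α ∈ exponents f, expVec α ⬝ᵥ (fun j => (u j : ℝ)) ≤ T) ∧
        T / d - n ≤ ∑ j, (u j : ℝ)) ∧ K * T ^ (n - 1 - dim P.face) ≤ U.card := by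
  classical
  obtain ⟨z, hzli, hz0, hz1, hzsum⟩ := P.exists_dual_directions
  generalize n - 1 - dim P.face = q at *
  have hd := P.d_pos
  let L : (Fin q → ℝ) →ₗ[ℝ] (Fin n → ℝ) := Fintype.linearCombination ℝ z
  have hLapp : ∀ t, L t = ∑ i, t i • z i := fun t => Fintype.linearCombination_apply ℝ z t
  have hL : LinearMap.ker L = ⊥ := by
    rw [LinearMap.ker_eq_bot']
    intro t ht
    rw [hLapp] at ht
    exact funext (Fintype.linearIndependent_iff.1 hzli t ht)
  obtain ⟨C, hC0, hC⟩ := L.exists_antilipschitzWith hL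
  have hC0 : (0 : ℝ) < C := hC0
  refine ⟨(1 / (C * (q + 1))) ^ q, by positivity, fun T hT => ?_⟩
  let M : ℕ := ⌊T / (C * (q + 1))⌋₊ + 1
  let Y : (Fin q → ℕ) → Fin n → ℝ := fun k => T • P.u + C • L fun i => (k i : ℝ)
  let I : Finset (Fin q → ℕ) := Fintype.piFinset fun _ => Finset.range M
  have hI : ∀ k ∈ I, ∑ i, C * (k i : ℝ) ≤ T := by
    intro k hk
    have h1 : ∀ i ∈ Finset.univ, C * (k i : ℝ) ≤ T / (q + 1) := by
      intro i _
      have h2 : k i ≤ ⌊T / (C * (q + 1))⌋₊ := by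
        have := Finset.mem_range.1 (Fintype.mem_piFinset.1 hk i)
        omega
      have h3 : (k i : ℝ) ≤ T / (C * (q + 1)) := (Nat.le_floor_iff (by positivity)).1 h2
      calc C * (k i : ℝ) ≤ C * (T / (C * (q + 1))) := by gcongr
        _ = T / (q + 1) := by field_simp
    refine (Finset.sum_le_card_nsmul _ _ _ h1).trans ?_
    rw [Finset.card_univ, Fintype.card_fin, nsmul_eq_mul, mul_div_assoc', div_le_iff₀ (by positivity)]
    nlinarith
  have hYapp : ∀ k j, Y k j = T * P.u j + ∑ i, C * (k i : ℝ) * z i j := by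
    intro k j
    simp only [Y, hLapp, Pi.add_apply, Pi.smul_apply, smul_eq_mul, Finset.sum_apply,
      Finset.mul_sum, NNReal.smul_def, mul_assoc]
  have hY0 : ∀ k ∈ I, ∀ j, 0 ≤ Y k j := by
    intro k hk j
    have h1 : ∑ i, C * (k i : ℝ) * -z i j ≤ ∑ i, C * (k i : ℝ) * P.u j :=
      Finset.sum_le_sum fun i _ => mul_le_mul_of_nonneg_left (by linarith [hz0 i j]) (by positivity)
    rw [← Finset.sum_mul] at h1
    have h2 := mul_le_mul_of_nonneg_right (hI k hk) (P.u_nonneg j)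
    simp only [mul_neg, Finset.sum_neg_distrib] at h1
    rw [hYapp]
    linarith
  have hYdot : ∀ k v, v ⬝ᵥ Y k = T * (v ⬝ᵥ P.u) + ∑ i, C * (k i : ℝ) * (v ⬝ᵥ z i) := by
    intro k v
    simp only [Y, hLapp, dotProduct_add, dotProduct_smul, dotProduct_sum, smul_eq_mul,
      Finset.mul_sum, NNReal.smul_def, mul_assoc]
  have hYle : ∀ k ∈ I, ∀ v ∈ completeNewtonPolyhedron f, v ⬝ᵥ Y k ≤ T := by
    intro k hk v hv
    have h0 := P.dotProduct_u_le_one hv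
    have h1 : ∑ i, C * (k i : ℝ) * (v ⬝ᵥ z i) ≤ ∑ i, C * (k i : ℝ) * (1 - v ⬝ᵥ P.u) := by
      refine Finset.sum_le_sum fun i _ => mul_le_mul_of_nonneg_left ?_ (by positivity)
      have := hz1 i v hv
      rw [dotProduct_add] at this
      linarith
    rw [← Finset.sum_mul] at h1
    have h2 := mul_le_mul_of_nonneg_right (hI k hk) (sub_nonneg.2 h0)
    rw [hYdot]
    linarith
  have hYsum : ∀ k, ∑ j, Y k j = T / d := by
    intro k
    have h1 := P.diagonal_dotProduct_u
    have h2 : ∑ j, P.u j = 1 / d := by rw [eq_div_iff hd.ne', mul_comm]; exact h1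
    simp only [hYapp, Finset.sum_add_distrib]
    rw [Finset.sum_comm]
    simp only [← Finset.mul_sum, hzsum, h2, mul_zero, Finset.sum_const_zero, add_zero]
    ring
  let F : (Fin q → ℕ) → Fin n → ℕ := fun k j => ⌊Y k j⌋₊
  have hinj : Set.InjOn F I := by
    intro k hk k' hk' hkk
    by_contra hne
    obtain ⟨i, hi⟩ := Function.ne_iff.1 hne
    have h1 : (1 : ℝ) ≤ dist (fun i => (k i : ℝ)) (fun i => (k' i : ℝ)) := by
      refine le_trans ?_ (dist_le_pi_dist _ _ i)
      rw [Nat.dist_cast_real, Nat.dist_eq]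
      have : (1 : ℤ) ≤ |(k i : ℤ) - k' i| := Int.one_le_abs (by omega)
      exact_mod_cast this
    have h2 := hC.le_mul_dist (fun i => (k i : ℝ)) (fun i => (k' i : ℝ))
    have h3 : dist (Y k) (Y k') < 1 := by
      rw [dist_pi_lt_iff one_pos]
      intro j
      have a1 := Nat.floor_le (hY0 k hk j)
      have a2 := Nat.lt_floor_add_one (Y k j)
      have b1 := Nat.floor_le (hY0 k' hk' j)
      have b2 := Nat.lt_floor_add_one (Y k' j)
      have e : ⌊Y k j⌋₊ = ⌊Y k' j⌋₊ := congrFun hkk j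
      rw [e] at a1 a2
      rw [Real.dist_eq, abs_lt]
      constructor <;> linarith
    have h4 : dist (Y k) (Y k') = C * dist (L fun i => (k i : ℝ)) (L fun i => (k' i : ℝ)) := by
      simp only [Y, dist_add_left, NNReal.smul_def]
      rw [dist_smul₀, Real.norm_eq_abs, abs_of_pos hC0]
    linarith
  refine ⟨I.image F, ?_, ?_⟩
  · intro u hu
    obtain ⟨k, hk, rfl⟩ := Finset.mem_image.1 hu
    constructor
    · intro α hα
      refine le_trans ?_ (hYle k hk _ (Or.inl (expVec_mem_newtonPolyhedron hα)))
      exact Finset.sum_le_sum fun j _ =>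
        mul_le_mul_of_nonneg_left (Nat.floor_le (hY0 k hk j)) (Nat.cast_nonneg _)
    · rw [← hYsum k, sub_le_iff_le_add]
      calc ∑ j, Y k j ≤ ∑ j, ((F k j : ℝ) + 1) :=
            Finset.sum_le_sum fun j _ => (Nat.lt_floor_add_one _).le
        _ = _ := by simp [Finset.sum_add_distrib]
  · rw [Finset.card_image_of_injOn hinj, Fintype.card_piFinset, Finset.prod_const, Finset.card_range,
      Finset.card_univ, Fintype.card_fin, ← mul_pow]
    push_cast
    refine pow_le_pow_left₀ (by positivity) ?_ q
    rw [one_div, inv_mul_eq_div]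
    exact (Nat.lt_floor_add_one _).le.trans (le_of_eq (by simp [M]))

end DiagonalSupport

/-! ### Dyadic decomposition -/

/-- The integer points with nonzero coordinates at which every monomial of `f` is at most `2 ^ T` in
absolute value. -/
def boundedPoints (f : Fin m → MvPolynomial (Fin n) ℝ) (T : ℝ) : Set (Fin n → ℤ) :=
  {a | (∀ j, a j ≠ 0) ∧
    ∀ α ∈ exponents f, |monomialValue (fun j => (a j : ℝ)) α| ≤ (2 : ℝ) ^ T}

theorem monomialValue_two_pow (u : Fin n → ℕ) (α : Fin n →₀ ℕ) :
    monomialValue (fun j => (2 : ℝ) ^ u j) α =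
      (2 : ℝ) ^ (expVec α ⬝ᵥ fun j => (u j : ℝ)) := by
  simp only [monomialValue, ← pow_mul]
  rw [Finset.prod_pow_eq_pow_sum, ← Real.rpow_natCast]
  congr 1
  push_cast
  exact Finset.sum_congr rfl fun j _ => mul_comm _ _

theorem monomialValue_le_monomialValue {x y : Fin n → ℝ} (hx : ∀ j, 0 ≤ x j) (hxy : ∀ j, x j ≤ y j)
    (α : Fin n →₀ ℕ) : monomialValue x α ≤ monomialValue y α :=
  Finset.prod_le_prod (fun j _ => pow_nonneg (hx j) _) fun j _ => pow_le_pow_left₀ (hx j) (hxy j) _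

/-- The lattice points `u ≥ 0` with `α ⬝ u ≤ T` for all exponents `α`; when every variable occurs,
the restriction of the coordinates to `[0, T]` is automatic. -/
noncomputable def polarPoints (f : Fin m → MvPolynomial (Fin n) ℝ) (T : ℝ) :
    Finset (Fin n → ℕ) := by
  classical exact (Fintype.piFinset fun _ => Finset.range (⌊T⌋₊ + 1)).filter fun u =>
    ∀ α ∈ exponents f, expVec α ⬝ᵥ (fun j => (u j : ℝ)) ≤ T

/-- A box containing the integer points `a` with `2 ^ u j ≤ |a j| < 2 ^ (u j + 1)`. -/
noncomputable def dyadicBox (u : Fin n → ℕ) : Finset (Fin n → ℤ) :=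
  Fintype.piFinset fun j => Finset.Ioo (-2 ^ (u j + 1)) (2 ^ (u j + 1))

theorem card_dyadicBox_le (u : Fin n → ℕ) :
    ((dyadicBox u).card : ℝ) ≤ 4 ^ n * 2 ^ (∑ j, u j) := by
  have h : (dyadicBox u).card ≤ 4 ^ n * 2 ^ (∑ j, u j) := by
    rw [dyadicBox, Fintype.card_piFinset]
    calc ∏ j, (Finset.Ioo (-2 ^ (u j + 1) : ℤ) (2 ^ (u j + 1))).card
        ≤ ∏ j, 4 * 2 ^ u j := by
          refine Finset.prod_le_prod' fun j _ => ?_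
          rw [Int.card_Ioo, Int.toNat_le, pow_succ]
          push_cast
          linarith
      _ = 4 ^ n * 2 ^ (∑ j, u j) := by
          rw [Finset.prod_mul_distrib, Finset.prod_pow_eq_pow_sum]; simp
  exact_mod_cast h

theorem boundedPoints_subset {f : Fin m → MvPolynomial (Fin n) ℝ}
    (hvar : ∀ j, ∃ α ∈ exponents f, α j ≠ 0) (T : ℝ) :
    boundedPoints f T ⊆ ((polarPoints f T).biUnion dyadicBox : Finset (Fin n → ℤ)) := by
  classical
  rintro a ⟨ha0, ha⟩
  let u : Fin n → ℕ := fun j => Nat.log 2 (a j).natAbs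
  have hu1 : ∀ j, (2 : ℝ) ^ u j ≤ |(a j : ℝ)| := by
    intro j
    have h : 2 ^ u j ≤ (a j).natAbs := Nat.pow_log_le_self 2 (Int.natAbs_ne_zero.2 (ha0 j))
    rw [← Int.cast_abs, Int.abs_eq_natAbs]
    exact_mod_cast h
  have hpolar : ∀ α ∈ exponents f, expVec α ⬝ᵥ (fun j => (u j : ℝ)) ≤ T := by
    intro α hα
    have h1 := ha α hα
    rw [abs_monomialValue] at h1
    have h2 := (monomialValue_le_monomialValue (fun j => by positivity) hu1 α).trans h1
    rw [monomialValue_two_pow] at h2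
    exact (Real.rpow_le_rpow_left_iff one_lt_two).1 h2
  rw [Finset.mem_coe, Finset.mem_biUnion]
  refine ⟨u, ?_, ?_⟩
  · rw [polarPoints, Finset.mem_filter]
    refine ⟨?_, hpolar⟩
    rw [Fintype.mem_piFinset]
    intro j
    obtain ⟨α, hα, hαj⟩ := hvar j
    have h1 : (1 : ℝ) ≤ α j := by exact_mod_cast Nat.one_le_iff_ne_zero.2 hαj
    have h2 : expVec α j * (u j : ℝ) ≤ expVec α ⬝ᵥ (fun j => (u j : ℝ)) :=
      Finset.single_le_sum (f := fun j => expVec α j * (u j : ℝ))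
        (fun j _ => mul_nonneg (Nat.cast_nonneg _) (Nat.cast_nonneg _)) (Finset.mem_univ j)
    have h3 : (0 : ℝ) ≤ u j := Nat.cast_nonneg _
    have h4 := hpolar α hα
    simp only [expVec] at h2 h4
    rw [Finset.mem_range, Nat.lt_add_one_iff]
    exact Nat.le_floor (by nlinarith)
  · rw [dyadicBox, Fintype.mem_piFinset]
    intro j
    have h : (a j).natAbs < 2 ^ (u j + 1) := Nat.lt_pow_succ_log_self one_lt_two _
    have h : |a j| < 2 ^ (u j + 1) := by
      rw [Int.abs_eq_natAbs]; exact_mod_cast h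
    rw [Finset.mem_Ioo]
    exact abs_lt.1 h

theorem boundedPoints_finite {f : Fin m → MvPolynomial (Fin n) ℝ}
    (hvar : ∀ j, ∃ α ∈ exponents f, α j ≠ 0) (T : ℝ) : (boundedPoints f T).Finite :=
  (Finset.finite_toSet _).subset (boundedPoints_subset hvar T)

namespace DiagonalSupport

variable {f : Fin m → MvPolynomial (Fin n) ℝ} {d : ℝ} (P : DiagonalSupport f d)

theorem exists_ncard_boundedPoints_le (hvar : ∀ j, ∃ α ∈ exponents f, α j ≠ 0) :
    ∃ K : ℝ, 0 < K ∧ ∀ T : ℝ, 1 ≤ T →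
      ((boundedPoints f T).ncard : ℝ) ≤ K * ((2 : ℝ) ^ (T / d) * T ^ (n - 1 - dim P.face)) := by
  classical
  obtain ⟨K, hK0, hK⟩ := P.exists_sum_two_pow_le hvar
  refine ⟨4 ^ n * K, by positivity, fun T hT => ?_⟩
  have h1 := hK T hT (polarPoints f T) fun u hu => (Finset.mem_filter.1 hu).2
  have h2 : (boundedPoints f T).ncard ≤ ∑ u ∈ polarPoints f T, (dyadicBox u).card := by
    refine (Set.ncard_le_ncard (boundedPoints_subset hvar T) (Finset.finite_toSet _)).trans ?_
    rw [Set.ncard_coe_finset]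
    exact Finset.card_biUnion_le
  calc ((boundedPoints f T).ncard : ℝ)
      ≤ ∑ u ∈ polarPoints f T, ((dyadicBox u).card : ℝ) := by exact_mod_cast h2
    _ ≤ ∑ u ∈ polarPoints f T, 4 ^ n * (2 : ℝ) ^ (∑ j, u j) :=
        Finset.sum_le_sum fun u _ => card_dyadicBox_le u
    _ ≤ 4 ^ n * (K * ((2 : ℝ) ^ (T / d) * T ^ (n - 1 - dim P.face))) := by
        rw [← Finset.mul_sum]; gcongr
    _ = _ := by ring

theorem exists_le_ncard_boundedPoints (hvar : ∀ j, ∃ α ∈ exponents f, α j ≠ 0) :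
    ∃ K T₁ : ℝ, 0 < K ∧ ∀ T : ℝ, T₁ ≤ T →
      K * ((2 : ℝ) ^ (T / d) * T ^ (n - 1 - dim P.face)) ≤ ((boundedPoints f T).ncard : ℝ) := by
  classical
  obtain ⟨K, hK0, hK⟩ := P.exists_lattice_points_near_dual_face
  generalize n - 1 - dim P.face = q at *
  -- passing from `2 ^ u` to the whole dyadic box costs a factor `2 ^ |α|` in the monomials
  set A : ℝ := ∑ α ∈ exponents f, ∑ j, (α j : ℝ) with hA
  have hA0 : 0 ≤ A := Finset.sum_nonneg fun _ _ => Finset.sum_nonneg fun _ _ => Nat.cast_nonneg _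
  have hAα : ∀ α ∈ exponents f, ∑ j, (α j : ℝ) ≤ A := fun α hα =>
    Finset.single_le_sum (f := fun α : Fin n →₀ ℕ => ∑ j, (α j : ℝ))
      (fun _ _ => Finset.sum_nonneg fun _ _ => Nat.cast_nonneg _) hα
  refine ⟨(2 : ℝ) ^ (-A / d - n) * (K * (1 / 2) ^ q), 2 * A, by positivity, fun T hT => ?_⟩
  obtain ⟨U, hU, hUcard⟩ := hK (T - A) (by linarith)
  let box : (Fin n → ℕ) → Finset (Fin n → ℤ) := fun u =>
    Fintype.piFinset fun j => Finset.Ico (2 ^ u j) (2 ^ (u j + 1))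
  have hboxcard : ∀ u, (box u).card = 2 ^ ∑ j, u j := by
    intro u
    rw [Fintype.card_piFinset, ← Finset.prod_pow_eq_pow_sum]
    refine Finset.prod_congr rfl fun j _ => ?_
    rw [Int.card_Ico, pow_succ, mul_two, add_sub_cancel_left]
    exact Int.toNat_natCast (2 ^ u j)
  have hboxlog : ∀ u, ∀ a ∈ box u, ∀ j, Nat.log 2 (a j).toNat = u j := by
    intro u a ha j
    obtain ⟨h1, h2⟩ := Finset.mem_Ico.1 (Fintype.mem_piFinset.1 ha j)
    have h0 : (0 : ℤ) ≤ a j := le_trans (by positivity) h1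
    rw [Nat.log_eq_iff (Or.inr ⟨one_lt_two, by
      have : (0 : ℤ) < a j := lt_of_lt_of_le (by positivity) h1
      omega⟩)]
    rw [← Int.toNat_of_nonneg h0] at h1 h2
    exact ⟨by exact_mod_cast h1, by exact_mod_cast h2⟩
  have hdisj : (U : Set (Fin n → ℕ)).PairwiseDisjoint box := by
    intro u _ u' _ hne
    rw [Function.onFun, Finset.disjoint_left]
    intro a ha ha'
    exact hne (funext fun j => (hboxlog u a ha j).symm.trans (hboxlog u' a ha' j))
  have hsub : ((U.biUnion box : Finset (Fin n → ℤ)) : Set (Fin n → ℤ)) ⊆ boundedPoints f T := by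
    intro a ha
    obtain ⟨u, hu, ha⟩ := Finset.mem_biUnion.1 ha
    have hb : ∀ j, (2 : ℤ) ^ u j ≤ a j ∧ a j < 2 ^ (u j + 1) := fun j =>
      Finset.mem_Ico.1 (Fintype.mem_piFinset.1 ha j)
    have hpos : ∀ j, 0 < a j := fun j => lt_of_lt_of_le (by positivity) (hb j).1
    refine ⟨fun j => (hpos j).ne', fun α hα => ?_⟩
    have h1 : ∀ j, |(a j : ℝ)| ≤ 2 ^ (u j + 1) := by
      intro j
      have := hpos j
      rw [abs_of_pos (by exact_mod_cast this)]
      exact_mod_cast (hb j).2.le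
    rw [abs_monomialValue]
    refine (monomialValue_le_monomialValue (fun j => abs_nonneg _) h1 α).trans ?_
    rw [monomialValue_two_pow]
    refine Real.rpow_le_rpow_of_exponent_le one_le_two ?_
    have h2 := (hU u hu).1 α hα
    have h3 := hAα α hα
    have h4 : expVec α ⬝ᵥ (fun j => ((u j + 1 : ℕ) : ℝ)) =
        expVec α ⬝ᵥ (fun j => (u j : ℝ)) + ∑ j, (α j : ℝ) := by
      simp only [dotProduct, expVec, ← Finset.sum_add_distrib]
      refine Finset.sum_congr rfl fun j _ => ?_
      push_cast; ring
    rw [h4]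
    linarith
  have hcard : (U.card : ℝ) * (2 : ℝ) ^ ((T - A) / d - n) ≤ ((boundedPoints f T).ncard : ℝ) := by
    have h1 := Set.ncard_le_ncard hsub (boundedPoints_finite hvar T)
    rw [Set.ncard_coe_finset, Finset.card_biUnion hdisj] at h1
    have h2 : ∑ u ∈ U, ((box u).card : ℝ) ≤ ((boundedPoints f T).ncard : ℝ) := by exact_mod_cast h1
    refine le_trans ?_ h2
    rw [← nsmul_eq_mul]
    refine Finset.card_nsmul_le_sum _ _ _ fun u hu => ?_
    rw [hboxcard]
    push_cast
    rw [← Real.rpow_natCast]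
    refine Real.rpow_le_rpow_of_exponent_le one_le_two ?_
    push_cast
    exact (hU u hu).2
  refine le_trans ?_ hcard
  have e1 : (2 : ℝ) ^ ((T - A) / d - n) = (2 : ℝ) ^ (-A / d - n) * (2 : ℝ) ^ (T / d) := by
    rw [← Real.rpow_add two_pos]; congr 1; ring
  have h5 : K * ((1 / 2) ^ q * T ^ q) ≤ U.card := by
    rw [← mul_pow]
    refine le_trans ?_ hUcard
    gcongr
    · linarith
    · linarith
  rw [e1]
  calc _ = (K * ((1 / 2) ^ q * T ^ q)) * ((2 : ℝ) ^ (-A / d - n) * (2 : ℝ) ^ (T / d)) := by ring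
    _ ≤ _ := by gcongr

end DiagonalSupport

/-! ### Comparison of `latticePoints` with `boundedPoints` -/

/-- Each component of `f` is bounded by a multiple of its largest monomial. -/
theorem exists_boundedPoints_subset_latticePoints (f : Fin m → MvPolynomial (Fin n) ℝ) :
    ∃ A : ℝ, 0 < A ∧ ∀ r : ℝ, 0 < r →
      boundedPoints f (Real.logb 2 (A * r)) ⊆ latticePoints f r := by
  set A : ℝ := 1 + ∑ i, ∑ α ∈ (f i).support, |(f i).coeff α| with hA
  have hA0 : 0 < A := by positivity
  refine ⟨A⁻¹, by positivity, fun r hr a ⟨ha0, ha⟩ => ⟨ha0, fun i => ?_⟩⟩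
  have h2 : (2 : ℝ) ^ Real.logb 2 (A⁻¹ * r) = A⁻¹ * r :=
    Real.rpow_logb two_pos (by norm_num) (by positivity)
  rw [h2] at ha
  have h3 : ∑ α ∈ (f i).support, |(f i).coeff α| ≤ A := by
    have := Finset.single_le_sum (f := fun i => ∑ α ∈ (f i).support, |(f i).coeff α|)
      (fun i _ => Finset.sum_nonneg fun _ _ => abs_nonneg _) (Finset.mem_univ i)
    linarith
  rw [eval_eq_sum_monomialValue]
  calc |∑ α ∈ (f i).support, (f i).coeff α * monomialValue (fun j => (a j : ℝ)) α|
      ≤ ∑ α ∈ (f i).support, |(f i).coeff α| * (A⁻¹ * r) := by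
        refine (Finset.abs_sum_le_sum_abs _ _).trans (Finset.sum_le_sum fun α hα => ?_)
        rw [abs_mul]
        exact mul_le_mul_of_nonneg_left (ha α (mem_exponents.2 ⟨i, hα⟩)) (abs_nonneg _)
    _ ≤ A * (A⁻¹ * r) := by rw [← Finset.sum_mul]; gcongr
    _ = r := by field_simp

theorem MikhailovGindikin.exists_latticePoints_subset_boundedPoints
    {f : Fin m → MvPolynomial (Fin n) ℝ} (hf : MikhailovGindikin f) :
    ∃ C : ℝ, 0 < C ∧ ∀ r : ℝ, 0 < r →
      latticePoints f r ⊆ boundedPoints f (Real.logb 2 (C * r)) := by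
  obtain ⟨C, hC, h⟩ := hf.exists_monomialValue_le
  refine ⟨C, hC, fun r hr a ⟨ha0, ha⟩ => ⟨ha0, fun α hα => ?_⟩⟩
  rw [Real.rpow_logb two_pos (by norm_num) (by positivity)]
  exact h _ (fun j => by exact_mod_cast ha0 j) r ha α hα

/-- Finiteness forces every variable to occur in `f`: the coordinate of a variable that does not
occur could be changed freely. -/
theorem exists_exponent_ne_zero_of_finite {f : Fin m → MvPolynomial (Fin n) ℝ}
    (hfin : ∀ r : ℝ, 0 < r → (latticePoints f r).Finite) (j : Fin n) :
    ∃ α ∈ exponents f, α j ≠ 0 := by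
  by_contra hcon
  push Not at hcon
  let r : ℝ := 1 + ∑ i, |MvPolynomial.eval (fun _ => (1 : ℝ)) (f i)|
  have hr : 0 < r := by positivity
  refine Set.infinite_of_injective_forall_mem
    (f := fun k : ℕ => Function.update (1 : Fin n → ℤ) j ((k : ℤ) + 1)) ?_ ?_ (hfin r hr)
  · intro k k' h
    have := congrFun h j
    simpa using this
  · refine fun k => ⟨fun i => ?_, fun i => ?_⟩
    · by_cases hi : i = j
      · subst hi; simp only [Function.update_self]; omega
      · simp [hi]
    · have h1 : MvPolynomial.eval
          (fun i => ((Function.update (1 : Fin n → ℤ) j ((k : ℤ) + 1) i : ℤ) : ℝ)) (f i) =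
          MvPolynomial.eval (fun _ => (1 : ℝ)) (f i) := by
        simp only [eval_eq_sum_monomialValue]
        refine Finset.sum_congr rfl fun α hα => ?_
        congr 1
        refine Finset.prod_congr rfl fun i' _ => ?_
        by_cases hi : i' = j
        · subst hi; rw [hcon α (mem_exponents.2 ⟨i, hα⟩)]; simp
        · simp [hi]
      change |MvPolynomial.eval _ (f i)| ≤ r
      rw [h1]
      have := Finset.single_le_sum (f := fun i => |MvPolynomial.eval (fun _ => (1 : ℝ)) (f i)|)
        (fun i _ => abs_nonneg _) (Finset.mem_univ i)
      simp only [r]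
      linarith

theorem eventually_log_le_logb_two {c : ℝ} (hc : 0 < c) :
    ∀ᶠ r : ℝ in atTop, Real.log r ≤ Real.logb 2 (c * r) ∧ Real.logb 2 (c * r) ≤ 2 * Real.log r := by
  filter_upwards [Real.tendsto_log_atTop.eventually_ge_atTop (10 * |Real.log c|),
    eventually_gt_atTop 0] with r hr hr0
  have h1 := Real.log_two_gt_d9
  have h2 := Real.log_two_lt_d9
  have h3 := neg_abs_le (Real.log c)
  have h4 := le_abs_self (Real.log c)
  have h5 := abs_nonneg (Real.log c)
  rw [Real.logb, Real.log_mul hc.ne' hr0.ne', le_div_iff₀ (by linarith), div_le_iff₀ (by linarith)]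
  constructor <;> nlinarith

theorem two_rpow_logb_div {c r d : ℝ} (hc : 0 < c) (hr : 0 < r) :
    (2 : ℝ) ^ (Real.logb 2 (c * r) / d) = c ^ (1 / d) * r ^ (1 / d) := by
  rw [div_eq_mul_one_div, Real.rpow_mul zero_le_two, Real.rpow_logb two_pos (by norm_num)
    (by positivity), Real.mul_rpow hc.le hr.le]

end NewtonLattice

theorem theorem2p4 (n m : ℕ) (hn : 0 < n) (f : Fin m → MvPolynomial (Fin n) ℝ)
    (hf : NewtonLattice.MikhailovGindikin f) :
    ((∀ r : ℝ, 0 < r → (NewtonLattice.latticePoints f r).Finite) ↔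
      (NewtonLattice.coneOf (NewtonLattice.newtonPolyhedron f) ∩
        NewtonLattice.openOrthant n).Nonempty) ∧
    ((∀ r : ℝ, 0 < r → (NewtonLattice.latticePoints f r).Finite) →
      ∃ (d : ℝ) (Λ : Set (Fin n → ℝ)),
        NewtonLattice.IsFurthestDiagonal (NewtonLattice.completeNewtonPolyhedron f) d ∧
        NewtonLattice.IsSmallestFaceAt (NewtonLattice.completeNewtonPolyhedron f)
          (fun _ => d) Λ ∧
        ∃ K₁ K₂ : ℝ, 0 < K₁ ∧ 0 < K₂ ∧ ∀ᶠ r : ℝ in Filter.atTop,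
          K₁ * (r ^ (1 / d) * Real.log r ^ ((n : ℤ) - (NewtonLattice.dim Λ : ℤ) - 1)) ≤
              ((NewtonLattice.latticePoints f r).ncard : ℝ) ∧
            ((NewtonLattice.latticePoints f r).ncard : ℝ) ≤
              K₂ * (r ^ (1 / d) * Real.log r ^ ((n : ℤ) - (NewtonLattice.dim Λ : ℤ) - 1))) := by
  open NewtonLattice in
  obtain ⟨C, hC, hup⟩ := hf.exists_latticePoints_subset_boundedPoints
  obtain ⟨A, hA, hlow⟩ := exists_boundedPoints_subset_latticePoints f
  have hcone := coneOf_inter_openOrthant_nonempty_iff hn f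
  refine ⟨⟨fun hfin => hcone.2 (exists_exponent_ne_zero_of_finite hfin), fun hne r hr =>
    (boundedPoints_finite (hcone.1 hne) _).subset (hup r hr)⟩, fun hfin => ?_⟩
  have hvar := exists_exponent_ne_zero_of_finite hfin
  obtain ⟨d, hd⟩ := exists_isFurthestDiagonal hn (hcone.2 hvar)
  obtain ⟨P⟩ := exists_diagonalSupport hd
  obtain ⟨K₁, T₁, hK₁, hlower⟩ := P.exists_le_ncard_boundedPoints hvar
  obtain ⟨K₂, hK₂, hupper⟩ := P.exists_ncard_boundedPoints_le hvar
  have hexp : (n : ℤ) - (dim P.face : ℤ) - 1 = ((n - 1 - dim P.face : ℕ) : ℤ) := by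
    have := P.dim_face_lt
    omega
  refine ⟨d, P.face, hd, P.isSmallestFaceAt_face, K₁ * A ^ (1 / d),
    K₂ * C ^ (1 / d) * 2 ^ (n - 1 - dim P.face), by positivity, by positivity, ?_⟩
  simp only [hexp, zpow_natCast]
  generalize n - 1 - dim P.face = q at *
  filter_upwards [eventually_log_le_logb_two hC, eventually_log_le_logb_two hA,
    Filter.eventually_gt_atTop 0, Real.tendsto_log_atTop.eventually_ge_atTop (max 1 T₁)]
    with r hCr hAr hr hlog
  have hlog1 : 1 ≤ Real.log r := (le_max_left _ _).trans hlog
  have hlog2 : T₁ ≤ Real.log r := (le_max_right _ _).trans hlog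
  constructor
  · have h1 := hlower _ (hlog2.trans hAr.1)
    rw [two_rpow_logb_div hA hr] at h1
    have h2 : ((boundedPoints f (Real.logb 2 (A * r))).ncard : ℝ) ≤ (latticePoints f r).ncard := by
      exact_mod_cast Set.ncard_le_ncard (hlow r hr) (hfin r hr)
    refine le_trans ?_ (h1.trans h2)
    calc K₁ * A ^ (1 / d) * (r ^ (1 / d) * Real.log r ^ q)
        ≤ K₁ * A ^ (1 / d) * (r ^ (1 / d) * Real.logb 2 (A * r) ^ q) := by
          gcongr
          exact hAr.1
      _ = _ := by ring
  · have h1 := hupper _ (hlog1.trans hCr.1)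
    rw [two_rpow_logb_div hC hr] at h1
    have h2 : ((latticePoints f r).ncard : ℝ) ≤ (boundedPoints f (Real.logb 2 (C * r))).ncard := by
      exact_mod_cast Set.ncard_le_ncard (hup r hr) (boundedPoints_finite hvar _)
    refine h2.trans (h1.trans ?_)
    calc K₂ * (C ^ (1 / d) * r ^ (1 / d) * Real.logb 2 (C * r) ^ q)
        ≤ K₂ * (C ^ (1 / d) * r ^ (1 / d) * (2 * Real.log r) ^ q) := by
          gcongr
          · linarith
          · exact hCr.2
      _ = _ := by rw [mul_pow]; ring
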